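/- Fix integers $N,M\ge 0$ and a field $K$. For each row $i\in\{1,\dots,N\}$ let $a_1^{(i)},a_2^{(i)},b_1^{(i)},b_2^{(i)},c_1^{(i)},c_2^{(i)}\in K$ be free fermionic weights, i.e. $a_1^{(i)}a_2^{(i)}+b_1^{(i)}b_2^{(i)}=c_1^{(i)}c_2^{(i)}$, with $a_1^{(i)},b_1^{(i)}\neq 0$. (For example $a_1=A$, $a_2=yAB$, $b_1=AB$, $b_2=xA$, $c_1=(x+y)AB$, $c_2=A$ with $A,B\ne0$.) Consider the six-vertex model on a grid with rows $1,\dots,N$ numbered from bottom to top and columns $0,\dots,M$ numbered from left to right; every edge carries a spin $+$ or $-$. A vertex in row $i$ with spins (left, top, right, bottom) has weight $a_1^{(i)}$ for $(+,+,+,+)$, $a_2^{(i)}$ for $(-,-,-,-)$, $b_1^{(i)}$ for $(+,-,+,-)$, $b_2^{(i)}$ for $(-,+,-,+)$, $c_1^{(i)}$ for $(-,+,+,-)$, $c_2^{(i)}$ for $(+,-,-,+)$, and $0$ otherwise. For strict partitions $\alpha,\beta,\sigma,\tau$ let $Z(\mathfrak S^{\alpha/\beta}_{\sigma/\tau})$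 be the sum, over all assignments of spins to the edges whose right, left, bottom and top boundary edges are $-$ exactly at the parts of $\alpha,\beta,\sigma,\tau$ respectively, of the product of the weights of all vertices. A partition of length $\ell$ is a sequence $\lambda_1\ge\dots\ge\lambda_\ell\ge 0$, trailing zeros allowed; $\lambda+\rho:=(\lambda_1+\ell-1,\dots,\lambda_{\ell-1}+1,\lambda_\ell)$, which is strict; and $\rho^+_N:=(N,\dots,2,1)$. For $x,y\in K^N$ define $h_r[x|y]$ by $\sum_{r\ge0}h_r[x|y]t^r=\prod_{i=1}^N\frac{1+y_it}{1-x_it}$, with $h_r=0$ for $r<0$, and for partitions $\lambda,\mu$ of the same length $n$ let $s_{\lambda/\mu}[x|y]:=\det_{1\le i,j\le n}h_{\lambda_i-\mu_j-i+j}[x|y]$ be the skew supersymmetric Schur function. Let $\lambda,\mu$ be partitions of lengths $\ell,k$ such that all parts of $\lambda+\rho$ and $\mu+\rho$ are at most $M$. Put $x_i=b_2^{(i)}/a_1^{(i)}$ and $y_i=a_2^{(i)}/b_1^{(i)}$. For integers $s,t\ge0$ with $\ell+s=k+t$ put $$\tilde\lambda=\big((M+1+t-\ell)^s,\lambda_1+t,\dots,\lambda_\ell+t\big),\qquad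 \tilde\mu=(\mu_1,\dots,\mu_k,0^t),$$ so that $\tilde\lambda+\rho$ and $\tilde\mu+\rho$ are the strict partitions $(M+s+t,\dots,M+t+1,(\lambda+\rho)_1+t,\dots,(\lambda+\rho)_\ell+t)$ and $((\mu+\rho)_1+t,\dots,(\mu+\rho)_k+t,t-1,\dots,0)$. A) If $\ell=k$, then $$Z(\mathfrak S^{\emptyset/\emptyset}_{\lambda+\rho/\mu+\rho})=\prod_{i=1}^N (a_1^{(i)})^{M+1-\ell}(b_1^{(i)})^{\ell}\cdot s_{\lambda/\mu}[x|y].$$ B) If $\ell+N=k$ (so $s=N$, $t=0$) and the denominator below is nonzero, then $$Z(\mathfrak S^{\rho^+_N/\emptyset}_{\lambda+\rho/\mu+\rho})=\frac{\prod_{i=1}^N (a_1^{(i)})^{M+1-\ell}(b_1^{(i)})^{\ell+N}\cdot s_{\tilde\lambda/\mu}[x|y]}{\prod_{i=1}^N c_1^{(i)}\cdot\prod_{i<j}\big(a_1^{(j)}a_2^{(i)}+b_1^{(i)}b_2^{(j)}\big)}.$$ C) If $\ell=k+N$ (so $s=0$, $t=N$) and the denominator below is nonzero, then $$Z(\mathfrak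 S^{\emptyset/\rho^+_N}_{\lambda+\rho/\mu+\rho})=\frac{\prod_{i=1}^N (a_1^{(i)})^{M+1+N-\ell}(b_1^{(i)})^{\ell}\cdot s_{\tilde\lambda/\tilde\mu}[x|y]}{\prod_{i=1}^N c_2^{(i)}\cdot\prod_{i<j}\big(a_1^{(i)}a_2^{(j)}+b_1^{(j)}b_2^{(i)}\big)}.$$ D) If $\ell=k$ (so $s=t=N$) and the denominator below is nonzero, then $$Z(\mathfrak S^{\rho^+_N/\rho^+_N}_{\lambda+\rho/\mu+\rho})=\frac{\prod_{i=1}^N (a_1^{(i)})^{M+1+N-\ell}(b_1^{(i)})^{\ell+N}\cdot s_{\tilde\lambda/\tilde\mu}[x|y]}{\prod_{i=1}^N c_1^{(i)}c_2^{(i)}\cdot\prod_{i\ne j}\big(a_1^{(j)}a_2^{(i)}+b_1^{(i)}b_2^{(j)}\big)}.$$ -/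

import Mathlib

/-- Spins on the edges of the grid; `minus` marks the presence of a path. -/
inductive Spin
  | plus
  | minus
  deriving DecidableEq

instance : Fintype Spin := ⟨{Spin.plus, Spin.minus}, by rintro (_ | _) <;> simp⟩

/-- The six Boltzmann weights of one row. -/
structure SixVertexWeights (K : Type*) where
  a1 : K
  a2 : K
  b1 : K
  b2 : K
  c1 : K
  c2 : K

/-- The free fermion condition on the weights of one row. -/
def SixVertexWeights.FreeFermionic {K : Type*} [Field K] (w : SixVertexWeights K) : Prop :=
  w.a1 * w.a2 + w.b1 * w.b2 = w.c1 * w.c2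

/-- The four-parameter family of free fermionic weights with row parameters `x, y, A, B`. -/
def SixVertexWeights.ofParameters {K : Type*} [Field K] (x y A B : K) : SixVertexWeights K where
  a1 := A
  a2 := y * A * B
  b1 := A * B
  b2 := x * A
  c1 := (x + y) * A * B
  c2 := A

theorem SixVertexWeights.freeFermionic_ofParameters {K : Type*} [Field K] (x y A B : K) :
    (SixVertexWeights.ofParameters x y A B).FreeFermionic := by
  simp only [SixVertexWeights.FreeFermionic, SixVertexWeights.ofParameters]
  ring

/-- The weight of a vertex, given the spins of its left, top, right and bottom edges
(in this order). Paths of `minus` spins move up and to the left. A vertex that is not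
admissible has weight `0`. -/
def vertexWeight {K : Type*} [Field K] (w : SixVertexWeights K) : Spin → Spin → Spin → Spin → K
  | .plus, .plus, .plus, .plus => w.a1
  | .minus, .minus, .minus, .minus => w.a2
  | .plus, .minus, .plus, .minus => w.b1
  | .minus, .plus, .minus, .plus => w.b2
  | .minus, .plus, .plus, .minus => w.c1
  | .plus, .minus, .minus, .plus => w.c2
  | _, _, _, _ => 0

/-- Spin of the boundary edge with label `m`, when the `minus` edges are the parts of `p`. -/
def boundarySpin {n : ℕ} (p : Fin n → ℕ) (m : ℕ) : Spin :=
  if ∃ i, p i = m then Spin.minus else Spin.plus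

/-- An assignment of spins to the edges of a grid with `N` rows and `M + 1` columns.
The rows `1, …, N` (here `0, …, N - 1`) are counted from bottom to top, the columns `0, …, M`
from left to right. `vert i c` is the vertical edge of column `c` below row `i` (for `i = N`,
the top boundary), and `horiz i c` is the horizontal edge of row `i` to the left of column `c`
(for `c = M + 1`, the right boundary). -/
abbrev GridSpins (N M : ℕ) : Type :=
  (Fin (N + 1) → Fin (M + 1) → Spin) × (Fin N → Fin (M + 2) → Spin)

/-- The right, left, bottom and top boundary edges are `minus` exactly on the parts of
`α`, `β`, `lam` and `mu`, respectively. Row labels start at `1`, column labels at `0`. -/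
def HasBoundary {N M s t l k : ℕ} (α : Fin s → ℕ) (β : Fin t → ℕ) (lam : Fin l → ℕ)
    (mu : Fin k → ℕ) (σ : GridSpins N M) : Prop :=
  (∀ i : Fin N, σ.2 i (Fin.last (M + 1)) = boundarySpin α (i + 1)) ∧
  (∀ i : Fin N, σ.2 i 0 = boundarySpin β (i + 1)) ∧
  (∀ c : Fin (M + 1), σ.1 0 c = boundarySpin lam c) ∧
  (∀ c : Fin (M + 1), σ.1 (Fin.last N) c = boundarySpin mu c)

instance {N M s t l k : ℕ} (α : Fin s → ℕ) (β : Fin t → ℕ) (lam : Fin l → ℕ) (mu : Fin k → ℕ) :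
    DecidablePred (HasBoundary (N := N) (M := M) α β lam mu) := fun σ => by
  unfold HasBoundary
  infer_instance

/-- The weight of an assignment of spins: the product of the weights of all vertices. -/
def gridWeight {K : Type*} [Field K] {N M : ℕ} (w : Fin N → SixVertexWeights K)
    (σ : GridSpins N M) : K :=
  ∏ i : Fin N, ∏ c : Fin (M + 1),
    vertexWeight (w i) (σ.2 i c.castSucc) (σ.1 i.succ c) (σ.2 i c.succ) (σ.1 i.castSucc c)

/-- The partition function of the six-vertex model with row weights `w`, columns `0, …, M`, and
right, left, bottom and top boundary conditions given by the strict partitions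
`α`, `β`, `lam` and `mu`. -/
def partitionFunction {K : Type*} [Field K] {N : ℕ} (M : ℕ) (w : Fin N → SixVertexWeights K)
    {s t l k : ℕ} (α : Fin s → ℕ) (β : Fin t → ℕ) (lam : Fin l → ℕ) (mu : Fin k → ℕ) : K :=
  ∑ σ : GridSpins N M with HasBoundary α β lam mu σ, gridWeight w σ

/-- The empty partition. -/
def emptyPartition : Fin 0 → ℕ := Fin.elim0

/-- `(N, N - 1, …, 1)`. -/
def rhoPlus (N : ℕ) : Fin N → ℕ := fun i => N - i

/-- `lam + ρ`, where `ρ = (l - 1, …, 1, 0)`. -/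
def addRho {l : ℕ} (lam : Fin l → ℕ) : Fin l → ℕ := fun i => lam i + (l - 1 - i)

/-- For a strict partition `p` of length `l`, the strict partition
`(M + s + t, …, M + t + 1, p₁ + t, …, p_l + t)`. -/
def extendBottomStrict (M s t : ℕ) {l : ℕ} (p : Fin l → ℕ) : Fin (s + l) → ℕ :=
  Fin.append (fun j : Fin s => M + s + t - j) (fun i => p i + t)

/-- For a strict partition `q` of length `k`, the strict partition
`(q₁ + t, …, q_k + t, t - 1, …, 1, 0)`. -/
def extendTopStrict (t : ℕ) {k : ℕ} (q : Fin k → ℕ) : Fin (k + t) → ℕ :=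
  Fin.append (fun i => q i + t) (fun j : Fin t => t - 1 - j)

/-- The partition `((M + 1 + t - l)^s, lam₁ + t, …, lam_l + t)`. -/
def extendBottom (M s t : ℕ) {l : ℕ} (lam : Fin l → ℕ) : Fin (s + l) → ℕ :=
  Fin.append (fun _ : Fin s => M + 1 + t - l) (fun i => lam i + t)

/-- The partition `(mu₁, …, mu_k, 0^t)`. -/
def extendTop (t : ℕ) {k : ℕ} (mu : Fin k → ℕ) : Fin (k + t) → ℕ :=
  Fin.append mu (fun _ : Fin t => 0)

/-- `extendBottom` is `extendBottomStrict` up to the shift by `ρ`. -/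
theorem addRho_extendBottom (M s t : ℕ) {l : ℕ} (lam : Fin l → ℕ) (hl : l ≤ M + 1) :
    addRho (extendBottom M s t lam) = extendBottomStrict M s t (addRho lam) := by
  funext i
  refine Fin.addCases (fun j => ?_) (fun j => ?_) i
  · have := j.isLt
    simp only [addRho, extendBottom, extendBottomStrict, Fin.append_left, Fin.val_castAdd]
    omega
  · simp only [addRho, extendBottom, extendBottomStrict, Fin.append_right, Fin.val_natAdd]
    omega

/-- `extendTop` is `extendTopStrict` up to the shift by `ρ`. -/
theorem addRho_extendTop (t : ℕ) {k : ℕ} (mu : Fin k → ℕ) :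
    addRho (extendTop t mu) = extendTopStrict t (addRho mu) := by
  funext i
  refine Fin.addCases (fun j => ?_) (fun j => ?_) i
  · have := j.isLt
    simp only [addRho, extendTop, extendTopStrict, Fin.append_left, Fin.val_castAdd]
    omega
  · have := j.isLt
    simp only [addRho, extendTop, extendTopStrict, Fin.append_right, Fin.val_natAdd]
    omega

/-- The generating function `∏ i, (1 + y i * t) / (1 - x i * t)` of the complete supersymmetric
functions; `1 / (1 - x i * t)` is written as a geometric series. -/
noncomputable def superHSeries {K : Type*} [Field K] {N : ℕ} (x y : Fin N → K) : PowerSeries K :=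
  ∏ i : Fin N, ((1 + PowerSeries.C (y i) * PowerSeries.X) * PowerSeries.mk fun n => x i ^ n)

/-- The complete supersymmetric function `h_r[x | y]`, which is `0` for `r < 0`. -/
noncomputable def superH {K : Type*} [Field K] {N : ℕ} (x y : Fin N → K) (r : ℤ) : K :=
  if r < 0 then 0 else PowerSeries.coeff r.toNat (superHSeries x y)

/-- The skew supersymmetric Schur function `s_{lam / mu}[x | y]` of two partitions of the same
length, as the Jacobi–Trudi determinant of the `h_{lam_i - mu_j - i + j}[x | y]`. -/
noncomputable def skewSuperSchur {K : Type*} [Field K] {N m n : ℕ} (h : m = n)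
    (lam : Fin m → ℕ) (mu : Fin n → ℕ) (x y : Fin N → K) : K :=
  Matrix.det (Matrix.of fun i j : Fin m =>
    superH x y ((lam i : ℤ) - (mu (Fin.cast h j) : ℤ) - (i : ℤ) + (j : ℤ)))

/-! For left and right boundaries all `plus`, the transfer matrix of one free fermionic row is, up
to powers of `a1` and `b1`, given by the minors of the lower triangular Toeplitz matrix of `(1 + y
t) / (1 - x t)`, with rows at the `minus` positions below and columns at those above
(`rowMatrix_plus_eq_det`, by removing the last column of the grid). Stacking rows multiplies
transfer matrices. By Cauchy–Binet this multiplies the Toeplitz matrices, hence the series, so the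
whole grid is a minor for the product series (`gridMatrix_plus_plus`). Up to the shift by `ρ` this
minor is the Jacobi–Trudi determinant, which gives A.

In B, C and D the grid is enlarged by `N` columns for each full side: on the right with bottom
`minus` and top `plus`, on the left with bottom `plus` and top `minus`. The outer sides are then all
`plus`, so A applies to the enlarged grid. Conservation of paths forces every edge between an added
block and the old grid to be `minus`, so the enlarged partition function is the wanted one times
domain wall partition functions, which are the denominators.

The left domain wall function is a determinant of series coefficients (`gridMatrix_plus_minus`),
evaluated by `det_coeff_domainWallSeries`; a rotation by 180 degrees gives the right one. -/

/-! ### Cauchy–Binet over sets enumerated in decreasing order. -/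

open Finset in
/-- The Cauchy–Binet formula, with an arbitrary enumeration `e T` of each `l`-element subset. -/
theorem det_sum_mul_eq_sum_powersetCard {K ι : Type*} [CommRing K] [DecidableEq ι] {l : ℕ}
    (s : Finset ι) (A : Fin l → ι → K) (B : ι → Fin l → K) (e : Finset ι → Fin l → ι)
    (he : ∀ T : Finset ι, T.card = l → Function.Injective (e T) ∧ univ.image (e T) = T) :
    Matrix.det (Matrix.of fun i j => ∑ a ∈ s, A i a * B a j) =
      ∑ T ∈ powersetCard l s, Matrix.det (Matrix.of fun i j => A i (e T j)) *
        Matrix.det (Matrix.of fun i j => B (e T i) j) := by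
  have expand : Matrix.det (Matrix.of fun i j => ∑ a ∈ s, A i a * B a j) =
      ∑ f ∈ Fintype.piFinset (fun _ : Fin l => s),
        (∏ i, A i (f i)) * Matrix.det (Matrix.of fun i j => B (f i) j) := by
    have h1 : (Matrix.of fun i j => ∑ a ∈ s, A i a * B a j) =
        (fun i : Fin l => ∑ a ∈ s, A i a • (fun j => B a j)) := by
      funext i j
      simp [Finset.sum_apply]
    rw [h1]
    change (Matrix.detRowAlternating (R := K) (n := Fin l)).toMultilinearMap _ = _
    rw [MultilinearMap.map_sum_finset]
    refine sum_congr rfl fun f _ => ?_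
    rw [MultilinearMap.map_smul_univ]
    rfl
  have noninj : ∀ f : Fin l → ι, ¬ Function.Injective f →
      Matrix.det (Matrix.of fun i j => B (f i) j) = 0 := by
    intro f hf
    simp only [Function.Injective, not_forall] at hf
    obtain ⟨i, j, hij, hne⟩ := hf
    exact Matrix.det_zero_of_row_eq hne (by funext k; simp [hij])
  rw [expand, ← sum_filter_add_sum_filter_not _ (fun f => Function.Injective f)]
  rw [sum_eq_zero (s := filter (fun f => ¬ Function.Injective f) _)
    (fun f hf => by rw [noninj f (mem_filter.1 hf).2, mul_zero]), add_zero]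
  -- Injective choices of columns are grouped by their image `T`; those with image `T` are the `e T
  -- ∘ σ`, and the sum over `σ` rebuilds the minor of `A`.
  rw [← sum_fiberwise_of_maps_to (t := powersetCard l s) (g := fun f => univ.image f)]
  swap
  · intro f hf
    simp only [mem_filter, Fintype.mem_piFinset] at hf
    rw [mem_powersetCard]
    refine ⟨fun x hx => ?_, by rw [card_image_of_injective _ hf.2, card_fin]⟩
    obtain ⟨i, -, rfl⟩ := mem_image.1 hx
    exact hf.1 i
  refine sum_congr rfl fun T hT => ?_
  rw [mem_powersetCard] at hT
  obtain ⟨hinj, himg⟩ := he T hT.2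
  have hmem : ∀ x, x ∈ T ↔ ∃ i, e T i = x := fun x => by
    conv_lhs => rw [← himg]
    simp
  rw [← Matrix.det_transpose (Matrix.of fun i j => A i (e T j)), Matrix.det_apply, sum_mul]
  symm
  refine sum_bij (fun (σ : Equiv.Perm (Fin l)) _ => e T ∘ σ) ?_ ?_ ?_ ?_
  · intro σ _
    simp only [mem_filter, Fintype.mem_piFinset]
    refine ⟨⟨fun i => hT.1 ((hmem _).2 ⟨σ i, rfl⟩), hinj.comp σ.injective⟩, ?_⟩
    · ext x
      simp only [mem_image, mem_univ, true_and, Function.comp, hmem]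
      exact ⟨fun ⟨i, hi⟩ => ⟨σ i, hi⟩, fun ⟨i, hi⟩ => ⟨σ.symm i, by simpa using hi⟩⟩
  · intro σ _ σ' _ h
    ext i
    exact congrArg Fin.val (hinj (congrFun h i))
  · intro f hf
    simp only [mem_filter] at hf
    obtain ⟨⟨-, hfinj⟩, hfim⟩ := hf
    have hex : ∀ i, ∃ j, e T j = f i := by
      intro i
      rw [← hmem, ← hfim]
      exact mem_image_of_mem _ (mem_univ _)
    choose g hg using hex
    have hginj : Function.Injective g := fun i j hij => hfinj (by rw [← hg, ← hg, hij])
    refine ⟨Equiv.ofBijective g (Finite.injective_iff_bijective.1 hginj), mem_univ _, ?_⟩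
    funext i
    exact hg i
  · intro σ _
    have := Matrix.det_permute σ (Matrix.of fun i j => B (e T i) j)
    have h2 : (Matrix.of fun i j => B ((e T ∘ σ) i) j) =
        (Matrix.of fun i j => B (e T i) j).submatrix σ id := rfl
    rw [h2, this]
    simp only [Matrix.transpose_apply, Matrix.of_apply, Function.comp_apply, Units.smul_def,
      zsmul_eq_mul]
    ring

/-- The elements of an `l`-element set of natural numbers in decreasing order. -/
def Finset.decreasingEnum (l : ℕ) (T : Finset ℕ) : Fin l → ℕ :=
  if h : T.card = l then fun i => T.orderEmbOfFin h i.rev else fun _ => 0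

theorem Finset.strictAnti_decreasingEnum {l : ℕ} {T : Finset ℕ} (h : T.card = l) :
    StrictAnti (T.decreasingEnum l) := by
  intro i j hij
  simp only [Finset.decreasingEnum, h, dite_true]
  exact (T.orderEmbOfFin h).strictMono (Fin.rev_lt_rev.2 hij)

theorem Finset.image_decreasingEnum {l : ℕ} {T : Finset ℕ} (h : T.card = l) :
    Finset.univ.image (T.decreasingEnum l) = T := by
  ext x
  simp only [Finset.decreasingEnum, h, dite_true, mem_image, mem_univ, true_and]
  have := Set.ext_iff.1 (T.range_orderEmbOfFin h) x
  rw [Set.mem_range, mem_coe] at this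
  rw [← this]
  exact ⟨fun ⟨i, hi⟩ => ⟨i.rev, hi⟩, fun ⟨i, hi⟩ => ⟨i.rev, by simpa using hi⟩⟩

theorem Finset.exists_decreasingEnum_iff {l : ℕ} {T : Finset ℕ} (h : T.card = l) (m : ℕ) :
    (∃ i, T.decreasingEnum l i = m) ↔ m ∈ T := by
  conv_rhs => rw [← Finset.image_decreasingEnum h]
  simp

/-! ### Toeplitz matrices and the series of one row. -/

/-- The entries of the Toeplitz matrix of a power series. -/
noncomputable def toeplitz {K : Type*} [CommRing K] (f : PowerSeries K) (a b : ℕ) : K :=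
  if b ≤ a then PowerSeries.coeff (a - b) f else 0

/-- Lower triangularity makes the truncation to `n` indices harmless: only `b ≤ c ≤ a < n`
contribute. This is why a finite grid sees the full product of series. -/
theorem toeplitz_mul {K : Type*} [CommRing K] (f g : PowerSeries K) {n a : ℕ} (ha : a < n)
    (b : ℕ) :
    ∑ c ∈ Finset.range n, toeplitz f a c * toeplitz g c b = toeplitz (f * g) a b := by
  by_cases hab : b ≤ a
  · have h1 : ∑ c ∈ Finset.range n, toeplitz f a c * toeplitz g c b =
        ∑ c ∈ Finset.Ico b (a + 1), toeplitz f a c * toeplitz g c b := by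
      symm
      apply Finset.sum_subset
      · intro c hc
        simp only [Finset.mem_Ico, Finset.mem_range] at *
        omega
      · intro c _ hc
        simp only [Finset.mem_Ico, not_and_or, not_le, not_lt] at hc
        rcases hc with hc | hc
        · simp [toeplitz, not_le.2 hc]
        · simp [toeplitz, show ¬ c ≤ a by omega]
    rw [h1, Finset.sum_Ico_eq_sum_range, toeplitz, if_pos hab, mul_comm f g,
      PowerSeries.coeff_mul, Finset.Nat.sum_antidiagonal_eq_sum_range_succ
        (fun i j => PowerSeries.coeff i g * PowerSeries.coeff j f)]
    rw [show a + 1 - b = (a - b).succ by omega]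
    refine Finset.sum_congr rfl fun c hc => ?_
    rw [Finset.mem_range] at hc
    rw [toeplitz, toeplitz, if_pos (by omega), if_pos (by omega), mul_comm]
    congr 3 <;> omega
  · rw [toeplitz, if_neg hab]
    refine Finset.sum_eq_zero fun c _ => ?_
    simp only [toeplitz]
    split_ifs <;> first | omega | simp

theorem toeplitz_one {K : Type*} [CommRing K] (a b : ℕ) :
    toeplitz (1 : PowerSeries K) a b = if a = b then 1 else 0 := by
  rw [toeplitz, PowerSeries.coeff_one]
  split_ifs <;> first | rfl | omega

/-- The generating function `(1 + y t) / (1 - x t)` of a single row. -/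
noncomputable def superFactor {K : Type*} [Field K] (x y : K) : PowerSeries K :=
  (1 + PowerSeries.C y * PowerSeries.X) * PowerSeries.mk fun n => x ^ n

theorem coeff_zero_superFactor {K : Type*} [Field K] (x y : K) :
    PowerSeries.coeff 0 (superFactor x y) = 1 := by
  simp [superFactor]

theorem constantCoeff_superFactor {K : Type*} [Field K] (x y : K) :
    PowerSeries.constantCoeff (superFactor x y) = 1 := by
  simp [superFactor]

theorem coeff_succ_superFactor {K : Type*} [Field K] (x y : K) (m : ℕ) :
    PowerSeries.coeff (m + 1) (superFactor x y) = x ^ m * (x + y) := by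
  simp only [superFactor, add_mul, one_mul, map_add, PowerSeries.coeff_mk, mul_assoc,
    PowerSeries.coeff_C_mul, PowerSeries.coeff_succ_X_mul]
  ring

theorem det_eq_zero_entry_of_column_zero {K : Type*} [CommRing K] {n : ℕ}
    (A : Matrix (Fin (n + 1)) (Fin (n + 1)) K) (hA : ∀ i : Fin n, A i.succ 0 = 0) :
    A.det = A 0 0 * (A.submatrix Fin.succ Fin.succ).det := by
  rw [Matrix.det_succ_column_zero, Fin.sum_univ_succ]
  simp [hA]

theorem det_eq_zero_entry_of_row_zero {K : Type*} [CommRing K] {n : ℕ}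
    (A : Matrix (Fin (n + 1)) (Fin (n + 1)) K) (hA : ∀ j : Fin n, A 0 j.succ = 0) :
    A.det = A 0 0 * (A.submatrix Fin.succ Fin.succ).det := by
  rw [Matrix.det_succ_row_zero, Fin.sum_univ_succ]
  simp [hA]

/-! ### The determinant behind the domain wall partition function. -/

/-- The power series whose coefficients are the entries of the determinant for the six-vertex
model with left boundary `plus`, right boundary `minus` and empty bottom boundary. The last of the
parameters belongs to the top row, and to the row `0` of the determinant. -/
noncomputable def domainWallSeries {K : Type*} [Field K] :
    (N : ℕ) → (Fin N → K) → (Fin N → K) → Fin N → PowerSeries K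
  | 0, _, _ => Fin.elim0
  | N + 1, x, y => Fin.cons (PowerSeries.mk fun n => x (Fin.last N) ^ n) fun r =>
      domainWallSeries N (x ∘ Fin.castSucc) (y ∘ Fin.castSucc) r *
        superFactor (x (Fin.last N)) (y (Fin.last N))

/-- The identity `(1 - x t) * superFactor x y = 1 + y t`, multiplied by `f` and read off
coefficientwise. -/
theorem coeff_succ_mul_superFactor {K : Type*} [Field K] (f : PowerSeries K) (x y : K) (m : ℕ) :
    PowerSeries.coeff (m + 1) (f * superFactor x y) =
      PowerSeries.coeff (m + 1) f + y * PowerSeries.coeff m f +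
        x * PowerSeries.coeff m (f * superFactor x y) := by
  have h : superFactor x y = 1 + PowerSeries.C y * PowerSeries.X +
      PowerSeries.C x * PowerSeries.X * superFactor x y := by
    ext n
    rcases n with _ | _ | n
    · simp [coeff_zero_superFactor, mul_assoc]
    · simp only [coeff_succ_superFactor, map_add, mul_assoc, PowerSeries.coeff_C_mul,
        PowerSeries.coeff_succ_X_mul, coeff_zero_superFactor, PowerSeries.coeff_one,
        PowerSeries.coeff_X]
      simp
      ring
    · simp only [coeff_succ_superFactor, map_add, mul_assoc, PowerSeries.coeff_C_mul,
        PowerSeries.coeff_succ_X_mul, PowerSeries.coeff_one, PowerSeries.coeff_X]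
      simp
      ring
  have h2 : f * superFactor x y = f + PowerSeries.C y * (PowerSeries.X * f) +
      PowerSeries.C x * (PowerSeries.X * (f * superFactor x y)) := by
    conv_lhs => rw [h]
    ring
  conv_lhs => rw [h2]
  simp only [map_add, PowerSeries.coeff_C_mul, PowerSeries.coeff_succ_X_mul]

/-- Deleting the constant term acts on the `domainWallSeries` by a matrix with known
characteristic polynomial. -/
theorem exists_shift_matrix {K : Type*} [Field K] (N : ℕ) (x y : Fin N → K) :
    ∃ L : Matrix (Fin N) (Fin N) K,
      (∀ r m, PowerSeries.coeff (m + 1) (domainWallSeries N x y r) =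
        ∑ s, L r s * PowerSeries.coeff m (domainWallSeries N x y s)) ∧
      ∀ z : K, (L + z • (1 : Matrix (Fin N) (Fin N) K)).det = ∏ i, (x i + z) := by
  induction N with
  | zero => exact ⟨0, fun r => r.elim0, fun z => by simp⟩
  | succ N ih =>
    obtain ⟨L, hL, hdet⟩ := ih (x ∘ Fin.castSucc) (y ∘ Fin.castSucc)
    set F := domainWallSeries N (x ∘ Fin.castSucc) (y ∘ Fin.castSucc) with hF
    set a := x (Fin.last N) with ha
    set b := y (Fin.last N) with hb
    -- With `S = superFactor a b` and `D f = (f - f(0)) / t`, one has `D (1 / (1 - a t)) = a / (1 -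
    -- a t)` and `D (F r * S) = D (F r) * S + F r (0) * (a + b) / (1 - a t)`. The matrix is
    -- therefore block triangular with diagonal blocks `a` and the old `L`.
    refine ⟨Matrix.of (Fin.cons (Fin.cons a fun _ => 0) fun r =>
      Fin.cons (PowerSeries.coeff 0 (F r) * (a + b)) (L r)), ?_, ?_⟩
    · intro r m
      refine Fin.cases ?_ (fun r => ?_) r
      · simp [domainWallSeries, Fin.sum_univ_succ, pow_succ, mul_comm, ha]
      · simp only [domainWallSeries, Fin.sum_univ_succ, Matrix.of_apply, Fin.cons_succ,
          Fin.cons_zero, PowerSeries.coeff_mk]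
        rw [← hF, ← ha, ← hb]
        induction m with
        | zero =>
          rw [coeff_succ_mul_superFactor, hL]
          simp only [PowerSeries.coeff_zero_eq_constantCoeff, map_mul]
          rw [constantCoeff_superFactor]
          simp
          ring
        | succ m ihm =>
          rw [coeff_succ_mul_superFactor, ihm, hL, hL]
          simp only [coeff_succ_mul_superFactor, mul_add, Finset.sum_add_distrib, Finset.mul_sum]
          simp only [← hL, pow_succ]
          rw [show ∑ i, L r i * (b * PowerSeries.coeff m (F i)) =
            b * PowerSeries.coeff (m + 1) (F r) by
              rw [hL, Finset.mul_sum]; exact Finset.sum_congr rfl fun _ _ => by ring]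
          rw [show ∑ i, L r i * (a * PowerSeries.coeff m (F i * superFactor a b)) =
            ∑ i, a * (L r i * PowerSeries.coeff m (F i * superFactor a b)) from
              Finset.sum_congr rfl fun _ _ => by ring]
          rw [show ∑ i, b * (L r i * PowerSeries.coeff m (F i)) =
            b * PowerSeries.coeff (m + 1) (F r) by rw [hL, Finset.mul_sum]]
          ring
    · intro z
      rw [det_eq_zero_entry_of_row_zero]
      · rw [Fin.prod_univ_castSucc, mul_comm]
        have := hdet z
        simp only [Function.comp_apply] at this
        rw [← this]
        congr 1
        · congr 1
          ext i j
          simp [Matrix.one_apply]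
        · simp [ha]
      · intro j
        simp [Fin.ext_iff]

/-- Multiplying all series by `1 - a t` is a column operation. It turns row `0` into `1` and the
others into `F r * (1 + b t)`, whose shifted coefficients are `L + b` applied to those of `F`. The
shift matrix thus contributes the new factors `x i + b`. -/
theorem det_coeff_domainWallSeries {K : Type*} [Field K] (N : ℕ) (x y : Fin N → K) :
    (Matrix.of fun i j : Fin N => PowerSeries.coeff j (domainWallSeries N x y i)).det =
      ∏ i, ∏ j with i < j, (x i + y j) := by
  induction N with
  | zero => simp
  | succ N ih =>
    set F := domainWallSeries N (x ∘ Fin.castSucc) (y ∘ Fin.castSucc) with hF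
    obtain ⟨L, hL, hdet⟩ := exists_shift_matrix N (x ∘ Fin.castSucc) (y ∘ Fin.castSucc)
    rw [← hF] at hL
    set a := x (Fin.last N) with ha
    set b := y (Fin.last N) with hb
    set B : Matrix (Fin (N + 1)) (Fin (N + 1)) K :=
      Matrix.of (Fin.cons (Fin.cons 1 fun _ => 0) fun r =>
        Fin.cons (PowerSeries.coeff 0 (F r)) fun j => PowerSeries.coeff (j + 1) (F r) +
          b * PowerSeries.coeff j (F r)) with hB
    rw [Matrix.det_eq_of_forall_col_eq_smul_add_pred (B := B) (fun _ => a)]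
    · rw [det_eq_zero_entry_of_row_zero]
      · have h1 : B.submatrix Fin.succ Fin.succ = (L + b • (1 : Matrix (Fin N) (Fin N) K)) *
            Matrix.of fun i j : Fin N => PowerSeries.coeff j (F i) := by
          ext i j
          rw [Matrix.add_mul, Matrix.smul_mul, Matrix.one_mul]
          simp only [hB, Matrix.submatrix_apply, Matrix.of_apply, Fin.cons_succ,
            Matrix.add_apply, Matrix.smul_apply, smul_eq_mul, hL,
            Matrix.mul_apply]
        rw [h1, Matrix.det_mul, hdet, ih]
        simp only [Finset.prod_filter, Fin.prod_univ_castSucc, Function.comp_apply,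
          Fin.castSucc_lt_castSucc_iff, Fin.castSucc_lt_last, if_true, lt_irrefl, if_false, mul_one,
          (Fin.castSucc_lt_last _).not_gt, Finset.prod_const_one, Finset.prod_mul_distrib]
        simp [hB, hb, mul_comm]
      · intro j
        simp [hB]
    · intro i
      refine Fin.cases ?_ (fun i => ?_) i
      · simp [hB, domainWallSeries]
      · simp [hB, domainWallSeries, constantCoeff_superFactor, hF]
    · intro i j
      refine Fin.cases ?_ (fun i => ?_) i
      · simp [hB, domainWallSeries, pow_succ, mul_comm, ha]
      · simp only [hB, domainWallSeries, Matrix.of_apply, Fin.cons_succ, Fin.val_succ,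
          Fin.val_castSucc]
        rw [coeff_succ_mul_superFactor]

/-! ### Transfer matrices of vertices, rows and grids. -/

/-- The number of paths through an edge with the given spin. -/
def Spin.count : Spin → ℕ
  | .plus => 0
  | .minus => 1

/-- The transfer matrix of a single vertex with given top and bottom spins. -/
def columnMatrix {K : Type*} [Field K] (w : SixVertexWeights K) (t b : Spin) :
    Matrix Spin Spin K :=
  Matrix.of fun l r => vertexWeight w l t r b

/-- The transfer matrix of a row with `n` columns and given left and right spins, indexed by the
spins below and above the row. -/
def rowMatrix {K : Type*} [Field K] (w : SixVertexWeights K) (n : ℕ) (L R : Spin) :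
    Matrix (Fin n → Spin) (Fin n → Spin) K :=
  Matrix.of fun bot top => (List.ofFn fun c => columnMatrix w (top c) (bot c)).prod L R

/-- The transfer matrix of a grid with `n` columns and given left and right spins. -/
def gridMatrix {K : Type*} [Field K] {N : ℕ} (w : Fin N → SixVertexWeights K) (n : ℕ)
    (L R : Fin N → Spin) : Matrix (Fin n → Spin) (Fin n → Spin) K :=
  (List.ofFn fun i => rowMatrix (w i) n (L i) (R i)).prod

theorem Spin.sum_eq {K : Type*} [AddCommMonoid K] (f : Spin → K) :
    ∑ s, f s = f .plus + f .minus := by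
  change ∑ s ∈ {Spin.plus, Spin.minus}, f s = _
  rw [Finset.sum_pair (by simp)]

theorem sum_fin_succ_arrow {K ι : Type*} [AddCommMonoid K] [Fintype ι] {n : ℕ}
    (f : (Fin (n + 1) → ι) → K) :
    ∑ p, f p = ∑ x, ∑ p : Fin n → ι, f (Fin.cons x p) := by
  rw [← Equiv.sum_comp (Fin.consEquiv fun _ => ι), Fintype.sum_prod_type]
  rfl

theorem list_prod_ofFn_apply {K ι : Type*} [CommRing K] [Fintype ι] [DecidableEq ι] (N : ℕ)
    (A : Fin N → Matrix ι ι K) (i j : ι) :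
    (List.ofFn A).prod i j =
      ∑ p : Fin (N + 1) → ι, if p 0 = i ∧ p (Fin.last N) = j then
        ∏ k, A k (p k.castSucc) (p k.succ) else 0 := by
  induction N generalizing i with
  | zero =>
    simp only [List.ofFn_zero, List.prod_nil, Matrix.one_apply, Finset.univ_eq_empty,
      Finset.prod_empty]
    rw [sum_fin_succ_arrow]
    simp only [Finset.univ_unique, Finset.sum_singleton]
    rw [Finset.sum_eq_single i]
    · simp
    · intro b _ hb
      simp [hb]
    · simp
  | succ N ih =>
    rw [List.ofFn_succ, List.prod_cons, Matrix.mul_apply, sum_fin_succ_arrow]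
    symm
    rw [Finset.sum_eq_single_of_mem i (Finset.mem_univ i)]
    · symm
      simp only [ih, Finset.mul_sum]
      rw [Finset.sum_comm]
      refine Finset.sum_congr rfl fun p _ => ?_
      rw [Finset.sum_eq_single_of_mem (p 0) (Finset.mem_univ _)]
      · simp only [true_and, Fin.cons_zero, Fin.prod_univ_succ, Fin.castSucc_zero, Fin.cons_succ,
          ← Fin.succ_last, ← Fin.succ_castSucc, mul_ite, mul_zero]
      · intro k _ hk
        simp [hk.symm]
    · intro k _ hk
      simp [hk]

/-- Both levels of matrix products are expanded as sums over paths of indices: vertical spins index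
the product of rows, horizontal spins the product of columns inside each row. -/
theorem partitionFunction_eq_gridMatrix {K : Type*} [Field K] {N : ℕ} (M : ℕ)
    (w : Fin N → SixVertexWeights K) {s t l k : ℕ} (α : Fin s → ℕ) (β : Fin t → ℕ)
    (lam : Fin l → ℕ) (mu : Fin k → ℕ) :
    partitionFunction M w α β lam mu =
      gridMatrix w (M + 1) (fun i => boundarySpin β (i + 1)) (fun i => boundarySpin α (i + 1))
        (fun c => boundarySpin lam c) (fun c => boundarySpin mu c) := by
  rw [partitionFunction, gridMatrix, list_prod_ofFn_apply, Finset.sum_filter,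
    Fintype.sum_prod_type]
  refine Finset.sum_congr rfl fun v _ => ?_
  simp only [rowMatrix, Matrix.of_apply, list_prod_ofFn_apply]
  rw [Finset.prod_univ_sum, Fintype.piFinset_univ]
  simp only [Finset.prod_ite_zero]
  by_cases hv : v 0 = (fun c : Fin (M + 1) => boundarySpin lam c) ∧
      v (Fin.last N) = fun c : Fin (M + 1) => boundarySpin mu c
  · rw [if_pos hv]
    refine Finset.sum_congr rfl fun h _ => ?_
    have hiff : HasBoundary α β lam mu (v, h) ↔ ∀ i ∈ (Finset.univ : Finset (Fin N)),
        h i 0 = boundarySpin β (i + 1) ∧ h i (Fin.last (M + 1)) = boundarySpin α (i + 1) := by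
      simp only [HasBoundary, hv.1, hv.2, Finset.mem_univ, true_imp_iff, implies_true, and_true,
        forall_and]
      exact and_comm
    by_cases hb : HasBoundary α β lam mu (v, h)
    · rw [if_pos hb, if_pos (hiff.1 hb)]
      rfl
    · rw [if_neg hb, if_neg (mt hiff.2 hb)]
  · rw [if_neg hv]
    refine Finset.sum_eq_zero fun h _ => if_neg fun hb => hv ⟨?_, ?_⟩
    · funext c
      exact hb.2.2.1 c
    · funext c
      exact hb.2.2.2 c

theorem rowMatrix_succ {K : Type*} [Field K] (w : SixVertexWeights K) (n : ℕ) (L R : Spin)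
    (β τ : Fin (n + 1) → Spin) :
    rowMatrix w (n + 1) L R β τ =
      ∑ m, vertexWeight w L (τ 0) m (β 0) * rowMatrix w n m R (β ∘ Fin.succ) (τ ∘ Fin.succ) := by
  simp only [rowMatrix, Matrix.of_apply]
  rw [List.ofFn_succ, List.prod_cons, Matrix.mul_apply]
  rfl

theorem rowMatrix_succ_last {K : Type*} [Field K] (w : SixVertexWeights K) (n : ℕ) (L R : Spin)
    (β τ : Fin (n + 1) → Spin) :
    rowMatrix w (n + 1) L R β τ =
      ∑ m, rowMatrix w n L m (β ∘ Fin.castSucc) (τ ∘ Fin.castSucc) *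
        vertexWeight w m (τ (Fin.last n)) R (β (Fin.last n)) := by
  simp only [rowMatrix, Matrix.of_apply]
  rw [List.ofFn_succ_last, List.prod_append, List.prod_singleton, Matrix.mul_apply]
  rfl

theorem gridMatrix_succ {K : Type*} [Field K] {N : ℕ} (w : Fin (N + 1) → SixVertexWeights K)
    (n : ℕ) (L R : Fin (N + 1) → Spin) :
    gridMatrix w n L R = rowMatrix (w 0) n (L 0) (R 0) *
      gridMatrix (w ∘ Fin.succ) n (L ∘ Fin.succ) (R ∘ Fin.succ) := by
  simp only [gridMatrix]
  rw [List.ofFn_succ, List.prod_cons]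
  rfl

theorem gridMatrix_succ_last {K : Type*} [Field K] {N : ℕ}
    (w : Fin (N + 1) → SixVertexWeights K) (n : ℕ) (L R : Fin (N + 1) → Spin) :
    gridMatrix w n L R =
      gridMatrix (w ∘ Fin.castSucc) n (L ∘ Fin.castSucc) (R ∘ Fin.castSucc) *
        rowMatrix (w (Fin.last N)) n (L (Fin.last N)) (R (Fin.last N)) := by
  simp only [gridMatrix]
  rw [List.ofFn_succ_last, List.prod_append, List.prod_singleton]
  rfl

/-! ### Rotation, conservation of paths, and vertical cuts. -/

/-- The weights of a row after a rotation of the grid by 180 degrees. -/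
def SixVertexWeights.rotate {K : Type*} (w : SixVertexWeights K) : SixVertexWeights K :=
  { w with c1 := w.c2, c2 := w.c1 }

theorem vertexWeight_rotate {K : Type*} [Field K] (w : SixVertexWeights K) (l t r b : Spin) :
    vertexWeight w.rotate r b l t = vertexWeight w l t r b := by
  cases l <;> cases t <;> cases r <;> cases b <;> rfl

theorem rowMatrix_rotate {K : Type*} [Field K] (w : SixVertexWeights K) (n : ℕ) (L R : Spin)
    (β τ : Fin n → Spin) :
    rowMatrix w.rotate n R L (τ ∘ Fin.rev) (β ∘ Fin.rev) = rowMatrix w n L R β τ := by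
  induction n generalizing R with
  | zero => simp [rowMatrix, Matrix.one_apply, eq_comm]
  | succ n ih =>
    rw [rowMatrix_succ, rowMatrix_succ_last]
    refine Finset.sum_congr rfl fun m _ => ?_
    rw [← ih, mul_comm, ← vertexWeight_rotate]
    simp only [Function.comp_def, Fin.rev_succ, Fin.rev_zero]
    rfl

theorem gridMatrix_rotate {K : Type*} [Field K] {N : ℕ} (w : Fin N → SixVertexWeights K) (n : ℕ)
    (L R : Fin N → Spin) (β τ : Fin n → Spin) :
    gridMatrix (fun i => (w i.rev).rotate) n (R ∘ Fin.rev) (L ∘ Fin.rev) (τ ∘ Fin.rev)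
      (β ∘ Fin.rev) = gridMatrix w n L R β τ := by
  induction N generalizing τ with
  | zero =>
    simp only [gridMatrix, List.ofFn_zero, List.prod_nil, Matrix.one_apply]
    refine if_congr ?_ rfl rfl
    rw [Function.Surjective.right_cancellable Fin.rev_surjective, eq_comm]
  | succ N ih =>
    rw [gridMatrix_succ, gridMatrix_succ_last, Matrix.mul_apply, Matrix.mul_apply,
      ← Equiv.sum_comp (Equiv.arrowCongr (Fin.revPerm (n := n)) (Equiv.refl Spin))]
    refine Finset.sum_congr rfl fun κ _ => ?_
    have h : (Equiv.arrowCongr (Fin.revPerm (n := n)) (Equiv.refl Spin)) κ = κ ∘ Fin.rev := rfl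
    rw [h, ← ih, mul_comm, ← rowMatrix_rotate]
    simp only [Function.comp_def, Fin.rev_succ, Fin.rev_zero, Fin.rev_rev]
    rfl

/-- Each of the six admissible vertices has as many paths entering from the right and below as
leaving to the left and above; the horizontal edges inside the row cancel. -/
theorem rowMatrix_conservation {K : Type*} [Field K] (w : SixVertexWeights K) (n : ℕ) (L R : Spin)
    (β τ : Fin n → Spin) (h : rowMatrix w n L R β τ ≠ 0) :
    ∑ c, (β c).count + R.count = ∑ c, (τ c).count + L.count := by
  induction n generalizing L with
  | zero =>
    have : L = R := by
      by_contra hne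
      exact h (by simp [rowMatrix, hne])
    simp [this]
  | succ n ih =>
    rw [rowMatrix_succ] at h
    obtain ⟨m, -, hm⟩ := Finset.exists_ne_zero_of_sum_ne_zero h
    have h1 := ih _ _ _ (right_ne_zero_of_mul hm)
    have h2 : m.count + (β 0).count = (τ 0).count + L.count := by
      have := left_ne_zero_of_mul hm
      revert this
      generalize τ 0 = t
      generalize β 0 = b
      cases L <;> cases t <;> cases m <;> cases b <;> simp [vertexWeight, Spin.count]
    simp only [Fin.sum_univ_succ, Function.comp_apply] at h1 ⊢
    omega

theorem gridMatrix_conservation {K : Type*} [Field K] {N : ℕ} (w : Fin N → SixVertexWeights K)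
    (n : ℕ) (L R : Fin N → Spin) (β τ : Fin n → Spin) (h : gridMatrix w n L R β τ ≠ 0) :
    ∑ c, (β c).count + ∑ i, (R i).count = ∑ c, (τ c).count + ∑ i, (L i).count := by
  induction N generalizing β with
  | zero =>
    have : β = τ := by
      by_contra hne
      exact h (by simp [gridMatrix, hne])
    simp [this]
  | succ N ih =>
    rw [gridMatrix_succ, Matrix.mul_apply] at h
    obtain ⟨κ, -, hκ⟩ := Finset.exists_ne_zero_of_sum_ne_zero h
    have h1 := ih _ _ _ _ (right_ne_zero_of_mul hκ)
    have h2 := rowMatrix_conservation _ _ _ _ _ _ (left_ne_zero_of_mul hκ)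
    simp only [Fin.sum_univ_succ, Function.comp_apply] at h1 ⊢
    omega

theorem rowMatrix_append {K : Type*} [Field K] (w : SixVertexWeights K) (m n : ℕ) (L R : Spin)
    (β τ : Fin m → Spin) (β' τ' : Fin n → Spin) :
    rowMatrix w (m + n) L R (Fin.append β β') (Fin.append τ τ') =
      ∑ s, rowMatrix w m L s β τ * rowMatrix w n s R β' τ' := by
  simp only [rowMatrix, Matrix.of_apply]
  rw [List.ofFn_add, List.prod_append, Matrix.mul_apply]
  simp [Fin.append_right]

theorem sum_sum_mul_sum_comm {K A B S P : Type*} [CommRing K] [Fintype A] [Fintype B] [Fintype S]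
    [Fintype P] (a : S → A → K) (b : S → B → K) (c : P → A → K) (d : P → B → K) :
    ∑ i, ∑ j, (∑ s, a s i * b s j) * ∑ p, c p i * d p j =
      ∑ s, ∑ p, (∑ i, a s i * c p i) * ∑ j, b s j * d p j := by
  simp only [Finset.sum_mul_sum]
  rw [Finset.sum_congr rfl fun _ _ => Finset.sum_comm, Finset.sum_comm]
  refine Finset.sum_congr rfl fun s _ => ?_
  rw [Finset.sum_congr rfl fun _ _ => Finset.sum_comm, Finset.sum_comm]
  exact Finset.sum_congr rfl fun p _ => Finset.sum_congr rfl fun i _ =>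
    Finset.sum_congr rfl fun j _ => by ring

/-- Cutting the grid along a vertical line leaves a sum over the spins `s` of the `N` horizontal
edges crossing it. -/
theorem gridMatrix_append {K : Type*} [Field K] {N : ℕ} (w : Fin N → SixVertexWeights K)
    (m n : ℕ) (L R : Fin N → Spin) (β τ : Fin m → Spin) (β' τ' : Fin n → Spin) :
    gridMatrix w (m + n) L R (Fin.append β β') (Fin.append τ τ') =
      ∑ s, gridMatrix w m L s β τ * gridMatrix w n s R β' τ' := by
  induction N generalizing β β' with
  | zero =>
    have h : Fin.append β β' = Fin.append τ τ' ↔ β = τ ∧ β' = τ' := by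
      refine ⟨fun h => ?_, fun h => by rw [h.1, h.2]⟩
      have := (Fin.appendEquiv m n (α := Spin)).injective (a₁ := (β, β')) (a₂ := (τ, τ')) h
      simpa using this
    simp only [gridMatrix, List.ofFn_zero, List.prod_nil, Matrix.one_apply, h]
    by_cases h1 : β = τ <;> simp [h1]
  | succ N ih =>
    simp only [gridMatrix_succ, Matrix.mul_apply]
    rw [← Equiv.sum_comp (Fin.appendEquiv m n), Fintype.sum_prod_type, sum_fin_succ_arrow]
    have h : ∀ κ κ', Fin.appendEquiv m n (κ, κ') = (Fin.append κ κ' : Fin (m + n) → Spin) :=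
      fun _ _ => rfl
    simp only [h, ih, rowMatrix_append]
    exact sum_sum_mul_sum_comm _ _ _ _

/-! ### Spin configurations of strict partitions. -/

/-- The spins of `n` edges which are `minus` exactly at the values of `p`. -/
def spinConfig (n : ℕ) {l : ℕ} (p : Fin l → ℕ) : Fin n → Spin := fun c => boundarySpin p c

theorem spinConfig_comp_castSucc (n : ℕ) {l : ℕ} (p : Fin l → ℕ) :
    spinConfig (n + 1) p ∘ Fin.castSucc = spinConfig n p := rfl

theorem spinConfig_cons (n : ℕ) {l : ℕ} (p : Fin l → ℕ) :
    spinConfig n (Fin.cons n p : Fin (l + 1) → ℕ) = spinConfig n p := by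
  funext c
  simp only [spinConfig, boundarySpin, Fin.exists_fin_succ, Fin.cons_zero, Fin.cons_succ,
    c.isLt.ne', false_or]

theorem spinConfig_cons_last (n : ℕ) {l : ℕ} (p : Fin l → ℕ) :
    spinConfig (n + 1) (Fin.cons n p : Fin (l + 1) → ℕ) (Fin.last n) = Spin.minus :=
  if_pos ⟨0, by simp⟩

theorem spinConfig_last_of_lt {n l : ℕ} {p : Fin l → ℕ} (hp : ∀ i, p i < n) :
    spinConfig (n + 1) p (Fin.last n) = Spin.plus :=
  if_neg fun ⟨i, hi⟩ => (hp i).ne (by simpa using hi)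

theorem strictAnti_cons_cases {l n : ℕ} {p : Fin (l + 1) → ℕ} (hp : StrictAnti p)
    (hn : ∀ i, p i < n + 1) :
    (∀ i, p i < n) ∨ ∃ p' : Fin l → ℕ, StrictAnti p' ∧ (∀ i, p' i < n) ∧ p = Fin.cons n p' := by
  by_cases h : p 0 = n
  · refine Or.inr ⟨p ∘ Fin.succ, hp.comp_strictMono (Fin.strictMono_succ), fun i => ?_, ?_⟩
    · rw [← h]
      exact hp (Fin.succ_pos i)
    · funext i
      refine Fin.cases ?_ (fun i => ?_) i <;> simp [h]
  · refine Or.inl fun i => ?_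
    have h0 := hn 0
    have := hp.antitone (Fin.zero_le i)
    omega

theorem length_le_of_strictAnti {l n : ℕ} {p : Fin l → ℕ} (hp : StrictAnti p)
    (hn : ∀ i, p i < n) : l ≤ n := by
  have := Fintype.card_le_of_injective (fun i => (⟨p i, hn i⟩ : Fin n))
    fun i j hij => hp.injective (Fin.ext_iff.1 hij)
  simpa using this

theorem det_cons_mul {K : Type*} [CommRing K] {n : ℕ} (c : K) (r : Fin (n + 1) → K)
    (A : Fin n → Fin (n + 1) → K) :
    (Matrix.of (Fin.cons (fun j => c * r j) A : Fin (n + 1) → Fin (n + 1) → K)).det =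
      c * (Matrix.of (Fin.cons r A : Fin (n + 1) → Fin (n + 1) → K)).det := by
  rw [Matrix.det_succ_row_zero, Matrix.det_succ_row_zero, Finset.mul_sum]
  refine Finset.sum_congr rfl fun j _ => ?_
  have : (Matrix.of (Fin.cons (fun j => c * r j) A :
      Fin (n + 1) → Fin (n + 1) → K)).submatrix Fin.succ j.succAbove =
      (Matrix.of (Fin.cons r A : Fin (n + 1) → Fin (n + 1) → K)).submatrix
        Fin.succ j.succAbove := rfl
  rw [this]
  simp only [Matrix.of_apply, Fin.cons_zero]
  ring

theorem toeplitz_self_superFactor {K : Type*} [Field K] (x y : K) (n : ℕ) :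
    toeplitz (superFactor x y) n n = 1 := by
  rw [toeplitz, if_pos le_rfl, Nat.sub_self, coeff_zero_superFactor]

theorem toeplitz_of_lt {K : Type*} [CommRing K] (f : PowerSeries K) {a b : ℕ} (h : a < b) :
    toeplitz f a b = 0 := if_neg h.not_ge

theorem toeplitz_superFactor_of_lt {K : Type*} [Field K] (x y : K) {a b : ℕ} (h : b < a) :
    toeplitz (superFactor x y) a b = (x + y) * x ^ (a - 1 - b) := by
  rw [toeplitz, if_pos h.le, show a - b = (a - 1 - b) + 1 by omega, coeff_succ_superFactor,
    mul_comm]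

/-! ### The determinant formula for a single row. -/

section RowFormula

variable {K : Type*} [Field K]

/-- The matrix whose determinant gives the transfer matrix of a row with `n` columns, left
boundary `plus` and right boundary `minus`. -/
noncomputable def borderedToeplitz (x y : K) (n : ℕ) {l : ℕ} (p : Fin l → ℕ)
    (q : Fin (l + 1) → ℕ) : Matrix (Fin (l + 1)) (Fin (l + 1)) K :=
  Matrix.of (Fin.cons (fun j => x ^ (n - 1 - q j)) fun i j =>
    toeplitz (superFactor x y) (p i) (q j))

theorem det_toeplitz_cons_cons (x y : K) {n l : ℕ} (p q : Fin l → ℕ) (hp : ∀ i, p i < n) :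
    (Matrix.of fun i j => toeplitz (superFactor x y) ((Fin.cons n p : Fin (l + 1) → ℕ) i)
      ((Fin.cons n q : Fin (l + 1) → ℕ) j)).det =
      (Matrix.of fun i j => toeplitz (superFactor x y) (p i) (q j)).det := by
  rw [det_eq_zero_entry_of_column_zero]
  · simp only [Matrix.of_apply, Fin.cons_zero, toeplitz_self_superFactor, one_mul]
    rfl
  · intro i
    exact toeplitz_of_lt _ (hp i)

theorem det_toeplitz_cons_left (x y : K) {n l : ℕ} (p : Fin l → ℕ) (q : Fin (l + 1) → ℕ)
    (hq : ∀ i, q i < n) :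
    (Matrix.of fun i j => toeplitz (superFactor x y) ((Fin.cons n p : Fin (l + 1) → ℕ) i)
      (q j)).det = (x + y) * (borderedToeplitz x y n p q).det := by
  rw [borderedToeplitz, ← det_cons_mul]
  congr 1
  ext i j
  refine Fin.cases ?_ (fun i => ?_) i
  · simp only [Matrix.of_apply, Fin.cons_zero]
    rw [toeplitz_superFactor_of_lt _ _ (hq j)]
  · simp

theorem det_toeplitz_cons_right (x y : K) {n l : ℕ} (p : Fin (l + 1) → ℕ) (q : Fin l → ℕ)
    (hp : ∀ i, p i < n) :
    (Matrix.of fun i j => toeplitz (superFactor x y) (p i)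
      ((Fin.cons n q : Fin (l + 1) → ℕ) j)).det = 0 :=
  Matrix.det_eq_zero_of_column_eq_zero 0 fun i => toeplitz_of_lt _ (hp i)

theorem det_borderedToeplitz_succ (x y : K) {n l : ℕ} (p : Fin l → ℕ) (q : Fin (l + 1) → ℕ)
    (hq : ∀ i, q i < n) :
    (borderedToeplitz x y (n + 1) p q).det = x * (borderedToeplitz x y n p q).det := by
  rw [borderedToeplitz, borderedToeplitz, ← det_cons_mul]
  congr 3
  funext j
  rw [← pow_succ']
  congr 1
  have := hq j
  omega

theorem det_borderedToeplitz_cons_right (x y : K) {n l : ℕ} (p q : Fin l → ℕ)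
    (hp : ∀ i, p i < n) :
    (borderedToeplitz x y (n + 1) p (Fin.cons n q)).det =
      (Matrix.of fun i j => toeplitz (superFactor x y) (p i) (q j)).det := by
  rw [borderedToeplitz, det_eq_zero_entry_of_column_zero]
  · simp only [Matrix.of_apply, Fin.cons_zero, Nat.add_sub_cancel, Nat.sub_self, pow_zero, one_mul]
    rfl
  · intro i
    exact toeplitz_of_lt _ (hp i)

theorem det_borderedToeplitz_cons_cons (x y : K) {n l : ℕ} (p : Fin l → ℕ) (q : Fin (l + 1) → ℕ)
    (hp : ∀ i, p i < n) (hq : ∀ i, q i < n) :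
    (borderedToeplitz x y (n + 1) (Fin.cons n p : Fin (l + 1) → ℕ) (Fin.cons n q)).det =
      y * (borderedToeplitz x y n p q).det := by
  have h01 : (1 : Fin (l + 2)) ≠ 0 := by simp
  -- Column `0` starts with `1, 1` and is zero below. Subtracting row `0` from row `1` clears it,
  -- and leaves `(x + y) * x ^ (n - 1 - q j) - x ^ (n - q j) = y * x ^ (n - 1 - q j)` in row `1`.
  rw [← Matrix.det_updateRow_add_smul_self _ h01 (-1), det_eq_zero_entry_of_column_zero]
  · rw [borderedToeplitz, borderedToeplitz, ← det_cons_mul]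
    simp only [Matrix.updateRow_ne h01.symm, Matrix.of_apply, Fin.cons_zero, Nat.add_sub_cancel,
      Nat.sub_self, pow_zero, one_mul]
    congr 1
    ext i j
    refine Fin.cases ?_ (fun i => ?_) i
    · have h1 : (0 : Fin (l + 1)).succ = 1 := rfl
      simp only [Matrix.submatrix_apply, h1, Matrix.updateRow_self, Pi.add_apply, Pi.smul_apply,
        Matrix.of_apply, Fin.cons_zero, Fin.cons_succ, smul_eq_mul]
      rw [← h1, Fin.cons_succ, Fin.cons_zero, Fin.cons_succ, toeplitz_superFactor_of_lt _ _ (hq j),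
        show n - q j = (n - 1 - q j) + 1 by have := hq j; omega, pow_succ]
      ring
    · have h1 : i.succ.succ ≠ 1 := by simp [Fin.ext_iff]
      rw [Matrix.submatrix_apply, Matrix.updateRow_ne h1]
      simp
  · intro i
    refine Fin.cases ?_ (fun i => ?_) i
    · have h1 : (0 : Fin (l + 1)).succ = 1 := rfl
      rw [h1, Matrix.updateRow_self, borderedToeplitz]
      simp only [Pi.add_apply, Pi.smul_apply, Matrix.of_apply]
      rw [← h1, Fin.cons_succ, Fin.cons_zero, Fin.cons_zero, Fin.cons_zero,
        toeplitz_self_superFactor]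
      simp
    · have h1 : i.succ.succ ≠ 1 := by simp [Fin.ext_iff]
      rw [Matrix.updateRow_ne h1]
      exact toeplitz_of_lt _ (hp i)

/-- The Toeplitz row of `n` is `x + y` times the border row, because every `q j` is below `n`. -/
theorem det_borderedToeplitz_cons_left (x y : K) {n l : ℕ} (p : Fin l → ℕ) (q : Fin (l + 2) → ℕ)
    (hq : ∀ i, q i < n) :
    (borderedToeplitz x y (n + 1) (Fin.cons n p : Fin (l + 1) → ℕ) q).det = 0 := by
  have h01 : (1 : Fin (l + 2)) ≠ 0 := by simp
  rw [det_borderedToeplitz_succ _ _ _ _ hq, ← Matrix.updateRow_eq_self (borderedToeplitz x y n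
    (Fin.cons n p : Fin (l + 1) → ℕ) q) 1]
  have h : borderedToeplitz x y n (Fin.cons n p : Fin (l + 1) → ℕ) q 1 =
      (x + y) • borderedToeplitz x y n (Fin.cons n p : Fin (l + 1) → ℕ) q 0 := by
    funext j
    exact toeplitz_superFactor_of_lt _ _ (hq j)
  rw [h, Matrix.det_updateRow_smul, Matrix.det_updateRow_eq_zero h01.symm, mul_zero, mul_zero]

/-- The two right boundaries are treated together, since the last vertex can turn one into the
other. Whether its bottom and top edges are occupied determines the vertex, and each of the eight
cases matches one recursion of the determinants. -/
theorem rowMatrix_plus_eq_det (w : SixVertexWeights K) (hff : w.FreeFermionic) (ha1 : w.a1 ≠ 0)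
    (hb1 : w.b1 ≠ 0) (n : ℕ) :
    (∀ (l : ℕ) (p q : Fin l → ℕ), StrictAnti p → StrictAnti q → (∀ i, p i < n) →
      (∀ i, q i < n) → rowMatrix w n .plus .plus (spinConfig n p) (spinConfig n q) =
        w.a1 ^ (n - l) * w.b1 ^ l * (Matrix.of fun i j =>
          toeplitz (superFactor (w.b2 / w.a1) (w.a2 / w.b1)) (p i) (q j)).det) ∧
    (∀ (l : ℕ) (p : Fin l → ℕ) (q : Fin (l + 1) → ℕ), StrictAnti p → StrictAnti q →
      (∀ i, p i < n) → (∀ i, q i < n) →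
      rowMatrix w n .plus .minus (spinConfig n p) (spinConfig n q) =
        w.a1 ^ (n - (l + 1)) * w.b1 ^ l * w.c2 *
          (borderedToeplitz (w.b2 / w.a1) (w.a2 / w.b1) n p q).det) := by
  have hxy : w.a1 * w.b1 * (w.b2 / w.a1 + w.a2 / w.b1) = w.c1 * w.c2 := by
    rw [← hff]
    field_simp
    ring
  have hx : w.a1 * (w.b2 / w.a1) = w.b2 := by field_simp
  have hy : w.b1 * (w.a2 / w.b1) = w.a2 := by field_simp
  generalize w.b2 / w.a1 = x at *
  generalize w.a2 / w.b1 = y at *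
  induction n with
  | zero =>
    refine ⟨fun l p q _ _ hp _ => ?_, fun l p q _ _ _ hq => absurd (hq 0) (Nat.not_lt_zero _)⟩
    obtain rfl : l = 0 := by
      by_contra hl
      exact absurd (hp ⟨0, Nat.pos_of_ne_zero hl⟩) (Nat.not_lt_zero _)
    have h0 : spinConfig 0 p = spinConfig 0 q := Subsingleton.elim _ _
    simp [rowMatrix]
  | succ n ih =>
    obtain ⟨ihp, ihm⟩ := ih
    refine ⟨fun l p q hp hq hpn hqn => ?_, fun l p q hp hq hpn hqn => ?_⟩
    · rw [rowMatrix_succ_last, Spin.sum_eq, spinConfig_comp_castSucc, spinConfig_comp_castSucc]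
      rcases l with _ | l
      · have hp' : ∀ i, p i < n := fun i => i.elim0
        have hq' : ∀ i, q i < n := fun i => i.elim0
        rw [spinConfig_last_of_lt hp', spinConfig_last_of_lt hq', ihp _ _ _ hp hq hp' hq']
        simp [vertexWeight, pow_succ]
      rcases strictAnti_cons_cases hp hpn with hp' | ⟨p', hp', hpn', rfl⟩ <;>
        rcases strictAnti_cons_cases hq hqn with hq' | ⟨q', hq', hqn', rfl⟩
      · rw [spinConfig_last_of_lt hp', spinConfig_last_of_lt hq', ihp _ _ _ hp hq hp' hq']
        have hl := length_le_of_strictAnti hp hp'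
        rw [show n + 1 - (l + 1) = (n - (l + 1)) + 1 by omega]
        simp only [vertexWeight]
        ring
      · rw [spinConfig_last_of_lt hp', spinConfig_cons_last, det_toeplitz_cons_right _ _ _ _ hp']
        simp [vertexWeight]
      · rw [spinConfig_last_of_lt hq', spinConfig_cons_last, spinConfig_cons,
          det_toeplitz_cons_left _ _ _ _ hq', ihm _ _ _ hp' hq hpn' hq']
        have hl := length_le_of_strictAnti hq hq'
        rw [show n + 1 - (l + 1) = (n - (l + 1)) + 1 by omega]
        simp only [vertexWeight, mul_zero, zero_add, pow_succ]
        -- The only use of the free fermion condition: the `c1` of this vertex meets the `c2` of the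
        -- shorter row, and `c1 * c2 = a1 * b1 * (x + y)`.
        linear_combination (-(w.a1 ^ (n - (l + 1)) * w.b1 ^ l *
          (borderedToeplitz x y n p' q).det)) * hxy
      · rw [spinConfig_cons_last, spinConfig_cons_last, spinConfig_cons, spinConfig_cons,
          det_toeplitz_cons_cons _ _ _ _ hpn', ihp _ _ _ hp' hq' hpn' hqn',
          Nat.add_sub_add_right]
        simp only [vertexWeight]
        ring
    · rw [rowMatrix_succ_last, Spin.sum_eq, spinConfig_comp_castSucc, spinConfig_comp_castSucc]
      -- For `l = 0` nothing is occupied below, so this case joins the one where column `n` is free.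
      have hcases : (∀ i, p i < n) ∨ ∃ l' : ℕ, ∃ hl : l = l' + 1, ∃ p' : Fin l' → ℕ,
          StrictAnti p' ∧ (∀ i, p' i < n) ∧ p = (Fin.cons n p' : Fin (l' + 1) → ℕ) ∘ Fin.cast hl := by
        rcases l with _ | l
        · exact Or.inl fun i => i.elim0
        · rcases strictAnti_cons_cases hp hpn with h | ⟨p', h1, h2, h3⟩
          · exact Or.inl h
          · exact Or.inr ⟨l, rfl, p', h1, h2, h3⟩
      rcases strictAnti_cons_cases hq hqn with hq' | ⟨q', hq', hqn', rfl⟩ <;>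
        rcases hcases with hp' | ⟨l, rfl, p', hp', hpn', rfl⟩
      · rw [spinConfig_last_of_lt hp', spinConfig_last_of_lt hq', ihm _ _ _ hp hq hp' hq',
          det_borderedToeplitz_succ _ _ _ _ hq']
        have hl := length_le_of_strictAnti hq hq'
        rw [show n + 1 - (l + 1) = (n - (l + 1)) + 1 by omega]
        simp only [vertexWeight, ← hx]
        ring
      · simp only [Fin.cast_eq_self, Function.comp_def]
        rw [spinConfig_last_of_lt hq', spinConfig_cons_last,
          det_borderedToeplitz_cons_left _ _ _ _ hq']
        simp [vertexWeight]
      · rw [spinConfig_last_of_lt hp', spinConfig_cons_last, spinConfig_cons,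
          det_borderedToeplitz_cons_right _ _ _ _ hp', ihp _ _ _ hp hq' hp' hqn',
          Nat.add_sub_add_right]
        simp only [vertexWeight]
        ring
      · simp only [Fin.cast_eq_self, Function.comp_def]
        rw [spinConfig_cons_last, spinConfig_cons_last, spinConfig_cons, spinConfig_cons,
          det_borderedToeplitz_cons_cons _ _ _ _ hpn' hqn', ihm _ _ _ hp' hq' hpn' hqn',
          Nat.add_sub_add_right]
        simp only [vertexWeight, ← hy]
        ring

end RowFormula

/-! ### Sums over spin configurations as sums over sets. -/

/-- The positions of the `minus` spins. -/
def minusSet {n : ℕ} (κ : Fin n → Spin) : Finset ℕ :=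
  (Finset.univ.filter fun c => κ c = Spin.minus).map Fin.valEmbedding

theorem mem_minusSet {n : ℕ} (κ : Fin n → Spin) (m : ℕ) :
    m ∈ minusSet κ ↔ ∃ h : m < n, κ ⟨m, h⟩ = Spin.minus := by
  simp only [minusSet, Finset.mem_map, Finset.mem_filter, Finset.mem_univ, true_and,
    Fin.valEmbedding_apply]
  exact ⟨by rintro ⟨a, ha, rfl⟩; exact ⟨a.isLt, ha⟩, fun ⟨h, h'⟩ => ⟨⟨m, h⟩, h', rfl⟩⟩

theorem minusSet_subset {n : ℕ} (κ : Fin n → Spin) : minusSet κ ⊆ Finset.range n := fun m hm =>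
  Finset.mem_range.2 ((mem_minusSet κ m).1 hm).1

theorem card_minusSet {n : ℕ} (κ : Fin n → Spin) : (minusSet κ).card = ∑ c, (κ c).count := by
  rw [minusSet, Finset.card_map, Finset.card_filter]
  refine Finset.sum_congr rfl fun c _ => ?_
  cases κ c <;> rfl

theorem Spin.eq_of_minus_iff {a b : Spin} (h : a = .minus ↔ b = .minus) : a = b := by
  cases a <;> cases b <;> simp_all

theorem spinConfig_eq_minus_iff {n l : ℕ} (p : Fin l → ℕ) (c : Fin n) :
    spinConfig n p c = Spin.minus ↔ ∃ i, p i = c := by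
  simp only [spinConfig, boundarySpin]
  split_ifs with h <;> simp [h]

theorem minusSet_spinConfig {n l : ℕ} {p : Fin l → ℕ} (hp : ∀ i, p i < n) :
    minusSet (spinConfig n p) = Finset.univ.image p := by
  ext m
  simp only [mem_minusSet, spinConfig_eq_minus_iff, Finset.mem_image, Finset.mem_univ, true_and]
  exact ⟨fun h => h.2, fun ⟨i, hi⟩ => ⟨hi ▸ hp i, i, hi⟩⟩

theorem sum_count_spinConfig {n l : ℕ} {p : Fin l → ℕ} (hp : StrictAnti p) (hn : ∀ i, p i < n) :
    ∑ c, (spinConfig n p c).count = l := by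
  rw [← card_minusSet, minusSet_spinConfig hn, Finset.card_image_of_injective _ hp.injective,
    Finset.card_fin]

theorem decreasingEnum_lt {n l : ℕ} {T : Finset ℕ} (hT : T ∈ Finset.powersetCard l (Finset.range n))
    (i : Fin l) : T.decreasingEnum l i < n := by
  rw [Finset.mem_powersetCard] at hT
  exact Finset.mem_range.1 (hT.1 ((Finset.exists_decreasingEnum_iff hT.2 _).1 ⟨i, rfl⟩))

/-- Turns the intermediate sum of a product of transfer matrices into the index set of Cauchy–Binet;
the hypothesis is supplied by conservation of paths. -/
theorem sum_spinConfig {K : Type*} [AddCommMonoid K] (l n : ℕ) (F : (Fin n → Spin) → K)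
    (hF : ∀ κ, ∑ c, (κ c).count ≠ l → F κ = 0) :
    ∑ κ, F κ = ∑ T ∈ Finset.powersetCard l (Finset.range n),
      F (spinConfig n (T.decreasingEnum l)) := by
  rw [← Finset.sum_filter_of_ne (p := fun κ : Fin n → Spin => (minusSet κ).card = l)
    (fun κ _ h => by
      rw [card_minusSet]
      by_contra hne
      exact h (hF κ hne))]
  have key : ∀ κ : Fin n → Spin, (minusSet κ).card = l →
      spinConfig n ((minusSet κ).decreasingEnum l) = κ := by
    intro κ hκ
    funext c
    refine Spin.eq_of_minus_iff ?_
    rw [spinConfig_eq_minus_iff, Finset.exists_decreasingEnum_iff hκ, mem_minusSet]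
    simp
  refine Finset.sum_bij' (fun κ _ => minusSet κ)
    (fun T _ => spinConfig n (T.decreasingEnum l)) ?_ ?_ ?_ ?_ ?_
  · intro κ hκ
    exact Finset.mem_powersetCard.2 ⟨minusSet_subset κ, (Finset.mem_filter.1 hκ).2⟩
  · intro T hT
    have h1 := Finset.mem_powersetCard.1 hT
    rw [Finset.mem_filter, minusSet_spinConfig (decreasingEnum_lt hT),
      Finset.image_decreasingEnum h1.2]
    exact ⟨Finset.mem_univ _, h1.2⟩
  · intro κ hκ
    exact key κ (Finset.mem_filter.1 hκ).2
  · intro T hT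
    rw [minusSet_spinConfig (decreasingEnum_lt hT),
      Finset.image_decreasingEnum (Finset.mem_powersetCard.1 hT).2]
  · intro κ hκ
    rw [key κ (Finset.mem_filter.1 hκ).2]

theorem det_sum_mul_eq_sum_decreasingEnum {K : Type*} [CommRing K] {l : ℕ} (n : ℕ)
    (A : Fin l → ℕ → K) (B : ℕ → Fin l → K) :
    Matrix.det (Matrix.of fun i j => ∑ a ∈ Finset.range n, A i a * B a j) =
      ∑ T ∈ Finset.powersetCard l (Finset.range n),
        Matrix.det (Matrix.of fun i j => A i (T.decreasingEnum l j)) *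
        Matrix.det (Matrix.of fun i j => B (T.decreasingEnum l i) j) :=
  det_sum_mul_eq_sum_powersetCard _ _ _ (fun T => T.decreasingEnum l) fun _ hT =>
    ⟨(Finset.strictAnti_decreasingEnum hT).injective, Finset.image_decreasingEnum hT⟩

/-! ### Determinant formulas for the grid and domain wall evaluations. -/

section GridFormula

variable {K : Type*} [Field K]

theorem gridMatrix_plus_plus {N : ℕ} (w : Fin N → SixVertexWeights K)
    (hff : ∀ i, (w i).FreeFermionic) (ha1 : ∀ i, (w i).a1 ≠ 0) (hb1 : ∀ i, (w i).b1 ≠ 0)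
    (n : ℕ) {l : ℕ} (p q : Fin l → ℕ) (hp : StrictAnti p) (hq : StrictAnti q)
    (hpn : ∀ i, p i < n) (hqn : ∀ i, q i < n) :
    gridMatrix w n (fun _ => .plus) (fun _ => .plus) (spinConfig n p) (spinConfig n q) =
      (∏ i, (w i).a1 ^ (n - l) * (w i).b1 ^ l) * (Matrix.of fun i j =>
        toeplitz (∏ i, superFactor ((w i).b2 / (w i).a1) ((w i).a2 / (w i).b1))
          (p i) (q j)).det := by
  induction N generalizing p with
  | zero =>
    simp only [gridMatrix, List.ofFn_zero, List.prod_nil, Finset.univ_eq_empty,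
      Finset.prod_empty, one_mul, toeplitz_one]
    by_cases hpq : p = q
    · subst hpq
      rw [Matrix.one_apply_eq]
      symm
      convert Matrix.det_one (n := Fin l) (R := K)
      ext i j
      simp [Matrix.one_apply, hp.injective.eq_iff]
    · rw [Matrix.one_apply_ne]
      · have hne : Finset.univ.image p ≠ Finset.univ.image q := by
          intro himg
          refine hpq (StrictAnti.range_inj hp hq |>.1 ?_)
          simpa using congrArg (fun s : Finset ℕ => (s : Set ℕ)) himg
        -- Without rows the determinant is a minor of the identity; for distinct index sets of equal
        -- size, some element of `p` missing from `q` gives a zero row.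
        have hns : ¬ Finset.univ.image p ⊆ Finset.univ.image q := fun hsub =>
          hne (Finset.eq_of_subset_of_card_le hsub (by
            rw [Finset.card_image_of_injective _ hp.injective,
              Finset.card_image_of_injective _ hq.injective]))
        obtain ⟨x, hx, hxq⟩ := Finset.not_subset.1 hns
        obtain ⟨i, -, rfl⟩ := Finset.mem_image.1 hx
        symm
        refine Matrix.det_eq_zero_of_row_eq_zero i fun j => if_neg fun hij => hxq ?_
        rw [hij]
        exact Finset.mem_image_of_mem _ (Finset.mem_univ _)
      · intro hcfg
        have := congrArg minusSet hcfg
        rw [minusSet_spinConfig hpn, minusSet_spinConfig hqn] at this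
        refine hpq (StrictAnti.range_inj hp hq |>.1 ?_)
        simpa using congrArg (fun s : Finset ℕ => (s : Set ℕ)) this
  | succ N ih =>
    rw [gridMatrix_succ, Matrix.mul_apply, sum_spinConfig l]
    swap
    · intro κ hκ
      by_cases h : rowMatrix (w 0) n .plus .plus (spinConfig n p) κ = 0
      · rw [h, zero_mul]
      · have := rowMatrix_conservation _ _ _ _ _ _ h
        rw [sum_count_spinConfig hp hpn] at this
        exact absurd this.symm hκ
    rw [Fin.prod_univ_succ, Fin.prod_univ_succ]
    simp only [← toeplitz_mul _ _ (hpn _)]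
    rw [det_sum_mul_eq_sum_decreasingEnum, Finset.mul_sum]
    refine Finset.sum_congr rfl fun T hT => ?_
    have hTlt := decreasingEnum_lt hT
    have hTanti := Finset.strictAnti_decreasingEnum (Finset.mem_powersetCard.1 hT).2
    rw [(rowMatrix_plus_eq_det (w 0) (hff 0) (ha1 0) (hb1 0) n).1 l p _ hp hTanti hpn hTlt]
    have := ih (w ∘ Fin.succ) (fun i => hff _) (fun i => ha1 _) (fun i => hb1 _) _ hTanti hTlt
    simp only [Function.comp_def] at this ⊢
    rw [this]
    ring

/-- The top row is split off. Its bordered determinant is expanded along the border so that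
Cauchy–Binet applies to each minor: the older series acquire the factor of the top row, and the
border becomes the row of `1 / (1 - x t)`. -/
theorem gridMatrix_plus_minus {N : ℕ} (w : Fin N → SixVertexWeights K)
    (hff : ∀ i, (w i).FreeFermionic) (ha1 : ∀ i, (w i).a1 ≠ 0) (hb1 : ∀ i, (w i).b1 ≠ 0)
    (n : ℕ) (q : Fin N → ℕ) (hq : StrictAnti q) (hqn : ∀ i, q i < n) :
    gridMatrix w n (fun _ => .plus) (fun _ => .minus) (fun _ => .plus) (spinConfig n q) =
      (∏ i : Fin N, (w i).a1 ^ (n - (i + 1)) * (w i).b1 ^ (i : ℕ) * (w i).c2) *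
        (Matrix.of fun i j => toeplitz (domainWallSeries N (fun i => (w i).b2 / (w i).a1)
          (fun i => (w i).a2 / (w i).b1) i) (n - 1) (q j)).det := by
  induction N with
  | zero =>
    have h : spinConfig n q = fun _ => Spin.plus := by
      funext c
      simp [spinConfig, boundarySpin]
    simp [gridMatrix, h]
  | succ N ih =>
    have hn : n - 1 < n := by
      have := hqn 0
      omega
    set a := (w (Fin.last N)).b2 / (w (Fin.last N)).a1 with ha
    set b := (w (Fin.last N)).a2 / (w (Fin.last N)).b1 with hb
    set F := domainWallSeries N ((fun i => (w i).b2 / (w i).a1) ∘ Fin.castSucc)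
      ((fun i => (w i).a2 / (w i).b1) ∘ Fin.castSucc) with hF
    rw [gridMatrix_succ_last, Matrix.mul_apply, sum_spinConfig N]
    swap
    · intro κ hκ
      by_cases h : gridMatrix (w ∘ Fin.castSucc) n (fun _ => .plus) (fun _ => .minus)
          (fun _ => .plus) κ = 0
      · exact mul_eq_zero_of_left h _
      · have := gridMatrix_conservation _ _ _ _ _ _ h
        simp only [Spin.count, Finset.sum_const_zero, zero_add, Finset.sum_const,
          Finset.card_univ, Fintype.card_fin, smul_eq_mul, mul_one, add_zero] at this
        exact absurd this.symm hκ
    have step : ∀ T ∈ Finset.powersetCard N (Finset.range n),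
        gridMatrix (w ∘ Fin.castSucc) n (fun _ => .plus) (fun _ => .minus) (fun _ => .plus)
          (spinConfig n (T.decreasingEnum N)) *
        rowMatrix (w (Fin.last N)) n .plus .minus (spinConfig n (T.decreasingEnum N))
          (spinConfig n q) =
        (∏ i : Fin (N + 1), (w i).a1 ^ (n - (i + 1)) * (w i).b1 ^ (i : ℕ) * (w i).c2) *
        ∑ j : Fin (N + 1), (-1) ^ (j : ℕ) * a ^ (n - 1 - q j) *
          ((Matrix.of fun r s => toeplitz (F r) (n - 1) (T.decreasingEnum N s)).det *
          (Matrix.of fun r s => toeplitz (superFactor a b) (T.decreasingEnum N r)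
            (q (j.succAbove s))).det) := by
      intro T hT
      have hTlt := decreasingEnum_lt hT
      have hTanti := Finset.strictAnti_decreasingEnum (Finset.mem_powersetCard.1 hT).2
      rw [(rowMatrix_plus_eq_det _ (hff _) (ha1 _) (hb1 _) n).2 N _ q hTanti hq hTlt hqn]
      have := ih (w ∘ Fin.castSucc) (fun i => hff _) (fun i => ha1 _) (fun i => hb1 _) _ hTanti
        hTlt
      rw [this, Fin.prod_univ_castSucc, borderedToeplitz, Matrix.det_succ_row_zero]
      simp only [Finset.mul_sum]
      refine Finset.sum_congr rfl fun j _ => ?_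
      have hsub : (Matrix.of (Fin.cons (fun j => a ^ (n - 1 - q j)) fun i j =>
          toeplitz (superFactor a b) (T.decreasingEnum N i) (q j) :
            Fin (N + 1) → Fin (N + 1) → K)).submatrix Fin.succ j.succAbove =
          Matrix.of fun r s => toeplitz (superFactor a b) (T.decreasingEnum N r)
            (q (j.succAbove s)) := rfl
      rw [hsub]
      simp only [Matrix.of_apply, Fin.cons_zero, Function.comp_def, Fin.val_castSucc, Fin.val_last,
        hF]
      ring
    refine (Finset.sum_congr rfl step).trans ?_
    rw [← Finset.mul_sum, Finset.sum_comm, Matrix.det_succ_row_zero]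
    congr 1
    refine Finset.sum_congr rfl fun j _ => ?_
    -- For fixed `j` the sum over `T` is Cauchy–Binet for the minor without column `j`, so the
    -- Laplace expansion along row `0` reappears.
    rw [← Finset.mul_sum, ← det_sum_mul_eq_sum_decreasingEnum n
      (fun r c => toeplitz (F r) (n - 1) c)
      (fun c s => toeplitz (superFactor a b) c (q (j.succAbove s)))]
    simp only [toeplitz_mul _ _ hn]
    congr 1
    · congr 1
      have := hqn j
      simp only [Matrix.of_apply, domainWallSeries, Fin.cons_zero]
      rw [toeplitz, if_pos (by omega), PowerSeries.coeff_mk]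

/-- Row `i` is below `N - (i + 1)` rows and above `i` rows. -/
theorem prod_prod_lt_mul {N : ℕ} (a b : Fin N → K) :
    ∏ i, ∏ j with i < j, a i * b j = ∏ i : Fin N, a i ^ (N - (i + 1)) * b i ^ (i : ℕ) := by
  simp only [Finset.prod_mul_distrib]
  congr 1
  · refine Finset.prod_congr rfl fun i _ => ?_
    rw [Finset.prod_const, show (Finset.univ.filter fun j => i < j) = Finset.Ioi i by ext; simp,
      Fin.card_Ioi, Nat.sub_sub, add_comm]
  · rw [Finset.prod_comm' (t' := Finset.univ) (s' := fun j => Finset.univ.filter fun i => i < j)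
      (by simp)]
    refine Finset.prod_congr rfl fun j _ => ?_
    rw [Finset.prod_const, show (Finset.univ.filter fun i => i < j) = Finset.Iio j by ext; simp,
      Fin.card_Iio]

/-- The domain wall partition function for the left block. -/
theorem gridMatrix_domainWall_left {N : ℕ} (w : Fin N → SixVertexWeights K)
    (hff : ∀ i, (w i).FreeFermionic) (ha1 : ∀ i, (w i).a1 ≠ 0) (hb1 : ∀ i, (w i).b1 ≠ 0) :
    gridMatrix w N (fun _ => .plus) (fun _ => .minus) (fun _ => .plus) (fun _ => .minus) =
      (∏ i, (w i).c2) *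
        ∏ i, ∏ j with i < j, ((w i).a1 * (w j).a2 + (w j).b1 * (w i).b2) := by
  have hq : StrictAnti fun j : Fin N => N - 1 - (j : ℕ) := fun i j hij => by
    have := j.isLt
    have : (i : ℕ) < j := hij
    dsimp only
    omega
  have h1 : (fun _ => Spin.minus) = spinConfig N fun j : Fin N => N - 1 - (j : ℕ) := by
    funext c
    symm
    rw [spinConfig_eq_minus_iff]
    exact ⟨c.rev, by rw [Fin.val_rev]; omega⟩
  refine (congrArg (gridMatrix w N (fun _ => .plus) (fun _ => .minus) fun _ => .plus) h1).trans ?_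
  rw [gridMatrix_plus_minus w hff ha1 hb1 N _ hq fun i => by have := i.isLt; omega]
  have h2 : ∀ (f : PowerSeries K) (j : Fin N),
      toeplitz f (N - 1) (N - 1 - j) = PowerSeries.coeff j f := by
    intro f j
    rw [toeplitz, if_pos (Nat.sub_le _ _), show N - 1 - (N - 1 - j) = (j : ℕ) by omega]
  simp only [h2]
  -- The powers of `a1` and `b1` are exactly one factor `a1` of row `i` and one `b1` of row `j` per
  -- pair `i < j`, which clears the denominators of `x i + y j`.
  rw [det_coeff_domainWallSeries, Finset.prod_mul_distrib, ← prod_prod_lt_mul,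
    mul_comm (∏ i, ∏ j with i < j, _), mul_assoc, ← Finset.prod_mul_distrib]
  congr 1
  refine Finset.prod_congr rfl fun i _ => ?_
  rw [← Finset.prod_mul_distrib]
  refine Finset.prod_congr rfl fun j _ => ?_
  have := ha1 i
  have := hb1 j
  field_simp
  ring

/-- The domain wall partition function for the right block. -/
theorem gridMatrix_domainWall_right {N : ℕ} (w : Fin N → SixVertexWeights K)
    (hff : ∀ i, (w i).FreeFermionic) (ha1 : ∀ i, (w i).a1 ≠ 0) (hb1 : ∀ i, (w i).b1 ≠ 0) :
    gridMatrix w N (fun _ => .minus) (fun _ => .plus) (fun _ => .minus) (fun _ => .plus) =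
      (∏ i, (w i).c1) *
        ∏ i, ∏ j with i < j, ((w j).a1 * (w i).a2 + (w i).b1 * (w j).b2) := by
  rw [← gridMatrix_rotate]
  refine (gridMatrix_domainWall_left (fun i => (w i.rev).rotate) (fun i => ?_) (fun i => ha1 _)
    (fun i => hb1 _)).trans ?_
  · have := hff i.rev
    simp only [SixVertexWeights.FreeFermionic, SixVertexWeights.rotate] at this ⊢
    rw [this, mul_comm]
  · simp only [SixVertexWeights.rotate]
    congr 1
    · exact Equiv.prod_comp Fin.revPerm fun i => (w i).c1
    -- Reversing the rows reverses each pair `i < j`, so the two indices are exchanged before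
    -- reindexing.
    · rw [Finset.prod_comm' (t' := Finset.univ)
        (s' := fun j => Finset.univ.filter fun i => i < j) (by simp),
        ← Equiv.prod_comp Fin.revPerm]
      refine Finset.prod_congr rfl fun i _ => ?_
      simp only [Finset.prod_filter]
      rw [← Equiv.prod_comp Fin.revPerm]
      refine Finset.prod_congr rfl fun j _ => ?_
      simp [Fin.rev_lt_rev]

theorem eq_minus_of_sum_count {N : ℕ} {s : Fin N → Spin} (h : ∑ i, (s i).count = N) :
    s = fun _ => Spin.minus := by
  have h1 : (Finset.univ.filter fun c => s c = Spin.minus) = Finset.univ := by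
    rw [← Finset.card_eq_iff_eq_univ, Fintype.card_fin, ← Finset.card_map Fin.valEmbedding]
    exact (card_minusSet s).trans h
  funext i
  have hi := Finset.mem_univ i
  rw [← h1] at hi
  exact (Finset.mem_filter.1 hi).2

/-- The `N` paths leaving at the top of the left block can only enter through the `N` edges of the
cut, so all of these are `minus`. -/
theorem gridMatrix_append_left {N : ℕ} (w : Fin N → SixVertexWeights K) (n : ℕ)
    (R : Fin N → Spin) (β τ : Fin n → Spin) :
    gridMatrix w (N + n) (fun _ => .plus) R
        (Fin.append (fun _ : Fin N => Spin.plus) β) (Fin.append (fun _ : Fin N => Spin.minus) τ) =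
      gridMatrix w N (fun _ => .plus) (fun _ => .minus) (fun _ => .plus) (fun _ => .minus) *
        gridMatrix w n (fun _ => .minus) R β τ := by
  rw [gridMatrix_append, Finset.sum_eq_single_of_mem _ (Finset.mem_univ fun _ => Spin.minus)]
  intro s _ hs
  by_contra hne
  have h := gridMatrix_conservation _ _ _ _ _ _ (left_ne_zero_of_mul hne)
  exact hs (eq_minus_of_sum_count (by simpa [Spin.count] using h))

theorem gridMatrix_append_right {N : ℕ} (w : Fin N → SixVertexWeights K) (n : ℕ)
    (L : Fin N → Spin) (β τ : Fin n → Spin) :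
    gridMatrix w (n + N) L (fun _ => .plus)
        (Fin.append β (fun _ : Fin N => Spin.minus)) (Fin.append τ (fun _ : Fin N => Spin.plus)) =
      gridMatrix w n L (fun _ => .minus) β τ *
        gridMatrix w N (fun _ => .minus) (fun _ => .plus) (fun _ => .minus) (fun _ => .plus) := by
  rw [gridMatrix_append, Finset.sum_eq_single_of_mem _ (Finset.mem_univ fun _ => Spin.minus)]
  intro s _ hs
  by_contra hne
  have h := gridMatrix_conservation _ _ _ _ _ _ (right_ne_zero_of_mul hne)
  exact hs (eq_minus_of_sum_count (by simpa [Spin.count, eq_comm] using h))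

end GridFormula

/-! ### Boundary conditions of the enlarged grid. -/

theorem strictAnti_addRho {l : ℕ} {lam : Fin l → ℕ} (h : Antitone lam) : StrictAnti (addRho lam) := by
  intro i j hij
  have h1 := h hij.le
  have h2 : (i : ℕ) < j := hij
  have := j.isLt
  simp only [addRho]
  omega

theorem strictAnti_append {m n : ℕ} {f : Fin m → ℕ} {g : Fin n → ℕ} (hf : StrictAnti f)
    (hg : StrictAnti g) (hfg : ∀ i j, g j < f i) : StrictAnti (Fin.append f g) := by
  intro i j
  refine Fin.addCases (fun i => ?_) (fun i => ?_) i <;>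
    refine Fin.addCases (fun j => ?_) (fun j => ?_) j <;> intro hij
  · simp only [Fin.append_left]
    exact hf hij
  · simp only [Fin.append_left, Fin.append_right]
    exact hfg i j
  · have h1 : m + (i : ℕ) < j := hij
    omega
  · simp only [Fin.append_right]
    exact hg (by simpa using hij)

theorem strictAnti_extendBottomStrict (M s t : ℕ) {l : ℕ} {p : Fin l → ℕ} (hp : StrictAnti p)
    (hM : ∀ i, p i ≤ M) : StrictAnti (extendBottomStrict M s t p) := by
  refine strictAnti_append (fun i j hij => ?_) (fun i j hij => ?_) fun i j => ?_
  · have : (i : ℕ) < j := hij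
    omega
  · exact Nat.add_lt_add_right (hp hij) t
  · have := hM j
    omega

theorem strictAnti_extendTopStrict (t : ℕ) {k : ℕ} {q : Fin k → ℕ} (hq : StrictAnti q) :
    StrictAnti (extendTopStrict t q) := by
  refine strictAnti_append (fun i j hij => Nat.add_lt_add_right (hq hij) t) (fun i j hij => ?_)
    fun i j => ?_
  · have : (i : ℕ) < j := hij
    omega
  · omega

theorem extendBottomStrict_lt {M s t l : ℕ} {p : Fin l → ℕ} (hM : ∀ i, p i ≤ M)
    (i : Fin (s + l)) : extendBottomStrict M s t p i < t + (M + 1 + s) := by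
  refine Fin.addCases (fun j => ?_) (fun j => ?_) i
  · simp only [extendBottomStrict, Fin.append_left]
    omega
  · have := hM j
    simp only [extendBottomStrict, Fin.append_right]
    omega

theorem extendTopStrict_lt {n t k : ℕ} {q : Fin k → ℕ} (hn : ∀ i, q i < n)
    (i : Fin (k + t)) : extendTopStrict t q i < t + n := by
  refine Fin.addCases (fun j => ?_) (fun j => ?_) i
  · have := hn j
    simp only [extendTopStrict, Fin.append_left]
    omega
  · simp only [extendTopStrict, Fin.append_right]
    omega

theorem boundarySpin_congr {l k : ℕ} {p : Fin l → ℕ} {q : Fin k → ℕ} {a b : ℕ}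
    (h : (∃ i, p i = a) ↔ ∃ i, q i = b) : boundarySpin p a = boundarySpin q b :=
  if_congr h rfl rfl

theorem exists_append_eq {m n : ℕ} (f : Fin m → ℕ) (g : Fin n → ℕ) (a : ℕ) :
    (∃ i, Fin.append f g i = a) ↔ (∃ i, f i = a) ∨ ∃ i, g i = a := by
  constructor
  · rintro ⟨i, hi⟩
    revert hi
    refine Fin.addCases (fun j => ?_) (fun j => ?_) i
    · rw [Fin.append_left]
      exact fun h => Or.inl ⟨j, h⟩
    · rw [Fin.append_right]
      exact fun h => Or.inr ⟨j, h⟩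
  · rintro (⟨i, hi⟩ | ⟨i, hi⟩)
    · exact ⟨Fin.castAdd n i, by rw [Fin.append_left, hi]⟩
    · exact ⟨Fin.natAdd m i, by rw [Fin.append_right, hi]⟩

theorem spinConfig_add_shift (n t : ℕ) {l : ℕ} (p : Fin l → ℕ) :
    spinConfig (t + n) (fun i => p i + t) =
      Fin.append (fun _ : Fin t => Spin.plus) (spinConfig n p) := by
  funext c
  refine Fin.addCases (fun j => ?_) (fun j => ?_) c
  · rw [Fin.append_left]
    refine if_neg fun ⟨i, hi⟩ => ?_
    have := j.isLt
    simp only [Fin.val_castAdd] at hi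
    omega
  · rw [Fin.append_right]
    refine boundarySpin_congr (exists_congr fun i => ?_)
    simp only [Fin.val_natAdd]
    omega

theorem spinConfig_add_of_lt {n l : ℕ} (N : ℕ) {p : Fin l → ℕ} (hp : ∀ i, p i < n) :
    spinConfig (n + N) p = Fin.append (spinConfig n p) (fun _ : Fin N => Spin.plus) := by
  funext c
  refine Fin.addCases (fun j => ?_) (fun j => ?_) c
  · rw [Fin.append_left]
    rfl
  · rw [Fin.append_right]
    refine if_neg fun ⟨i, hi⟩ => ?_
    have := hp i
    simp only [Fin.val_natAdd] at hi
    omega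

theorem spinConfig_extendTopStrict (n t : ℕ) {k : ℕ} (q : Fin k → ℕ) :
    spinConfig (t + n) (extendTopStrict t q) =
      Fin.append (fun _ : Fin t => Spin.minus) (spinConfig n q) := by
  funext c
  refine Fin.addCases (fun j => ?_) (fun j => ?_) c
  · rw [Fin.append_left]
    refine if_pos ((exists_append_eq _ _ _).2 (Or.inr ⟨j.rev, ?_⟩))
    simp only [Fin.val_castAdd, Fin.val_rev]
    omega
  · rw [Fin.append_right]
    refine boundarySpin_congr ((exists_append_eq _ _ _).trans ?_)
    simp only [Fin.val_natAdd]
    constructor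
    · rintro (⟨i, hi⟩ | ⟨i, hi⟩)
      · exact ⟨i, by omega⟩
      · omega
    · rintro ⟨i, hi⟩
      exact Or.inl ⟨i, by omega⟩

theorem spinConfig_extendBottomStrict_zero (M N : ℕ) {l : ℕ} (p : Fin l → ℕ) :
    spinConfig (M + 1 + N) (extendBottomStrict M N 0 p) =
      Fin.append (spinConfig (M + 1) p) (fun _ : Fin N => Spin.minus) := by
  funext c
  refine Fin.addCases (fun j => ?_) (fun j => ?_) c
  · rw [Fin.append_left]
    refine boundarySpin_congr ((exists_append_eq _ _ _).trans ?_)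
    simp only [Fin.val_castAdd, add_zero]
    refine or_iff_right fun ⟨i, hi⟩ => ?_
    omega
  · rw [Fin.append_right]
    refine if_pos ((exists_append_eq _ _ _).2 (Or.inl ⟨j.rev, ?_⟩))
    simp only [Fin.val_natAdd, Fin.val_rev]
    omega

theorem extendBottomStrict_eq_add (M s t : ℕ) {l : ℕ} (p : Fin l → ℕ) :
    extendBottomStrict M s t p = fun i => extendBottomStrict M s 0 p i + t := by
  funext i
  refine Fin.addCases (fun j => ?_) (fun j => ?_) i
  · simp only [extendBottomStrict, Fin.append_left]
    omega
  · simp only [extendBottomStrict, Fin.append_right, add_zero]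

/-! ### Jacobi–Trudi form and the four cases. -/

section Main

variable {K : Type*} [Field K]

/-- Equal lengths make the two shifts by `ρ` differ by `j - i`; negative indices correspond to the
zeros above the diagonal. -/
theorem skewSuperSchur_eq_det_toeplitz {N m n : ℕ} (h : m = n) (lam : Fin m → ℕ) (mu : Fin n → ℕ)
    (x y : Fin N → K) :
    skewSuperSchur h lam mu x y = (Matrix.of fun i j : Fin m =>
      toeplitz (∏ i, superFactor (x i) (y i)) (addRho lam i) (addRho mu (Fin.cast h j))).det := by
  subst h
  rw [skewSuperSchur]
  congr 1
  ext i j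
  have hij : (lam i : ℤ) - (mu j : ℤ) - (i : ℤ) + (j : ℤ) =
      (addRho lam i : ℤ) - (addRho mu j : ℤ) := by
    simp only [addRho]
    omega
  simp only [Matrix.of_apply, superH, toeplitz, Fin.cast_eq_self, hij, superHSeries, superFactor]
  by_cases hneg : addRho mu j ≤ addRho lam i
  · rw [if_neg (by omega), if_pos hneg]
    congr 2
    omega
  · rw [if_pos (by omega), if_neg hneg]

/-- The exponents `d` and `e` are free up to equations, so that each enlarged grid can be stated
with the exponents of the original one. -/
theorem gridMatrix_eq_skewSuperSchur {N : ℕ} (w : Fin N → SixVertexWeights K)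
    (hff : ∀ i, (w i).FreeFermionic) (ha1 : ∀ i, (w i).a1 ≠ 0) (hb1 : ∀ i, (w i).b1 ≠ 0)
    (n : ℕ) {l k : ℕ} (h : l = k) (lam : Fin l → ℕ) (mu : Fin k → ℕ)
    (hlam : StrictAnti (addRho lam)) (hmu : StrictAnti (addRho mu))
    (hlamn : ∀ i, addRho lam i < n) (hmun : ∀ i, addRho mu i < n) {d e : ℕ} (hd : n - l = d)
    (he : l = e) :
    gridMatrix w n (fun _ => .plus) (fun _ => .plus) (spinConfig n (addRho lam))
        (spinConfig n (addRho mu)) =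
      (∏ i, (w i).a1 ^ d * (w i).b1 ^ e) * skewSuperSchur h lam mu
        (fun i => (w i).b2 / (w i).a1) (fun i => (w i).a2 / (w i).b1) := by
  rw [skewSuperSchur_eq_det_toeplitz]
  subst h hd he
  exact gridMatrix_plus_plus w hff ha1 hb1 n _ _ hlam hmu hlamn hmun

theorem boundarySpin_emptyPartition (m : ℕ) : boundarySpin emptyPartition m = Spin.plus :=
  if_neg fun ⟨i, _⟩ => i.elim0

theorem boundarySpin_rhoPlus {N : ℕ} (i : Fin N) :
    boundarySpin (rhoPlus N) (i + 1) = Spin.minus :=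
  if_pos ⟨i.rev, by simp only [rhoPlus, Fin.val_rev]; omega⟩

/-- Splits the denominator of D into those of the two domain wall blocks. -/
theorem prod_prod_ne {N : ℕ} (g : Fin N → Fin N → K) :
    ∏ i, ∏ j with i ≠ j, g i j =
      (∏ i, ∏ j with i < j, g i j) * ∏ i, ∏ j with i < j, g j i := by
  rw [Finset.prod_comm' (s := Finset.univ) (t := fun i => Finset.univ.filter fun j => i < j)
    (f := fun i j => g j i) (t' := Finset.univ)
    (s' := fun j => Finset.univ.filter fun i => i < j) (by simp), ← Finset.prod_mul_distrib]
  refine Finset.prod_congr rfl fun i _ => ?_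
  rw [← Finset.prod_union]
  · refine Finset.prod_congr ?_ fun _ _ => rfl
    ext j
    simp only [Finset.mem_filter, Finset.mem_univ, true_and, Finset.mem_union]
    exact ne_iff_lt_or_gt
  · rw [Finset.disjoint_filter]
    exact fun j _ h => h.not_gt

end Main

theorem mainTheorem7 {K : Type*} [Field K] (N M l k : ℕ)
    (w : Fin N → SixVertexWeights K)
    (hff : ∀ i, (w i).FreeFermionic)
    (ha1 : ∀ i, (w i).a1 ≠ 0) (hb1 : ∀ i, (w i).b1 ≠ 0)
    (lam : Fin l → ℕ) (mu : Fin k → ℕ) (hlam : Antitone lam) (hmu : Antitone mu)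
    (hlamM : ∀ i, addRho lam i ≤ M) (hmuM : ∀ i, addRho mu i ≤ M) :
    -- A: both side boundaries empty
    (∀ h : l = k,
      partitionFunction M w emptyPartition emptyPartition (addRho lam) (addRho mu) =
        (∏ i, (w i).a1 ^ (M + 1 - l) * (w i).b1 ^ l) *
          skewSuperSchur h lam mu
            (fun i => (w i).b2 / (w i).a1) (fun i => (w i).a2 / (w i).b1)) ∧
    -- B: domain wall, right side boundary full
    (∀ h : N + l = k,
      (∀ i, (w i).c1 ≠ 0) →
      (∀ i j, i < j → (w j).a1 * (w i).a2 + (w i).b1 * (w j).b2 ≠ 0) →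
      partitionFunction M w (rhoPlus N) emptyPartition (addRho lam) (addRho mu) =
        ((∏ i, (w i).a1 ^ (M + 1 - l) * (w i).b1 ^ (l + N)) *
          skewSuperSchur h (extendBottom M N 0 lam) mu
            (fun i => (w i).b2 / (w i).a1) (fun i => (w i).a2 / (w i).b1)) /
        ((∏ i, (w i).c1) *
          ∏ i, ∏ j with i < j, ((w j).a1 * (w i).a2 + (w i).b1 * (w j).b2))) ∧
    -- C: left side boundary full
    (∀ h : 0 + l = k + N,
      (∀ i, (w i).c2 ≠ 0) →
      (∀ i j, i < j → (w i).a1 * (w j).a2 + (w j).b1 * (w i).b2 ≠ 0) →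
      partitionFunction M w emptyPartition (rhoPlus N) (addRho lam) (addRho mu) =
        ((∏ i, (w i).a1 ^ (M + 1 + N - l) * (w i).b1 ^ l) *
          skewSuperSchur h (extendBottom M 0 N lam) (extendTop N mu)
            (fun i => (w i).b2 / (w i).a1) (fun i => (w i).a2 / (w i).b1)) /
        ((∏ i, (w i).c2) *
          ∏ i, ∏ j with i < j, ((w i).a1 * (w j).a2 + (w j).b1 * (w i).b2))) ∧
    -- D: both side boundaries full
    (∀ h : N + l = k + N,
      (∀ i, (w i).c1 ≠ 0) → (∀ i, (w i).c2 ≠ 0) →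
      (∀ i j, i ≠ j → (w j).a1 * (w i).a2 + (w i).b1 * (w j).b2 ≠ 0) →
      partitionFunction M w (rhoPlus N) (rhoPlus N) (addRho lam) (addRho mu) =
        ((∏ i, (w i).a1 ^ (M + 1 + N - l) * (w i).b1 ^ (l + N)) *
          skewSuperSchur h (extendBottom M N N lam) (extendTop N mu)
            (fun i => (w i).b2 / (w i).a1) (fun i => (w i).a2 / (w i).b1)) /
        ((∏ i, (w i).c1 * (w i).c2) *
          ∏ i, ∏ j with i ≠ j, ((w j).a1 * (w i).a2 + (w i).b1 * (w j).b2))) := by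
  have hlamS := strictAnti_addRho hlam
  have hmuS := strictAnti_addRho hmu
  have hlamlt : ∀ i, addRho lam i < M + 1 := fun i => Nat.lt_succ_of_le (hlamM i)
  have hmult : ∀ i, addRho mu i < M + 1 := fun i => Nat.lt_succ_of_le (hmuM i)
  have hl : l ≤ M + 1 := length_le_of_strictAnti hlamS hlamlt
  have hright : ∀ s t, StrictAnti (addRho (extendBottom M s t lam)) := fun s t => by
    rw [addRho_extendBottom M s t lam hl]
    exact strictAnti_extendBottomStrict M s t hlamS hlamM
  have hbottom : ∀ s t i, addRho (extendBottom M s t lam) i < t + (M + 1 + s) := fun s t i => by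
    rw [addRho_extendBottom M s t lam hl]
    exact extendBottomStrict_lt hlamM i
  have htopS : StrictAnti (addRho (extendTop N mu)) := by
    rw [addRho_extendTop]
    exact strictAnti_extendTopStrict N hmuS
  simp only [partitionFunction_eq_gridMatrix, boundarySpin_emptyPartition, boundarySpin_rhoPlus]
  change (∀ h : l = k, gridMatrix w (M + 1) _ _ (spinConfig (M + 1) (addRho lam))
      (spinConfig (M + 1) (addRho mu)) = _) ∧
    (∀ h : N + l = k, _ → _ → gridMatrix w (M + 1) _ _ (spinConfig (M + 1) (addRho lam))
      (spinConfig (M + 1) (addRho mu)) = _) ∧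
    (∀ h : 0 + l = k + N, _ → _ → gridMatrix w (M + 1) _ _ (spinConfig (M + 1) (addRho lam))
      (spinConfig (M + 1) (addRho mu)) = _) ∧
    (∀ h : N + l = k + N, _ → _ → _ → gridMatrix w (M + 1) _ _ (spinConfig (M + 1) (addRho lam))
      (spinConfig (M + 1) (addRho mu)) = _)
  refine ⟨fun h => ?_, fun h hc1 hd => ?_, fun h hc2 hd => ?_, fun h hc1 hc2 hd => ?_⟩
  · exact gridMatrix_eq_skewSuperSchur w hff ha1 hb1 (M + 1) h lam mu hlamS hmuS hlamlt hmult
      rfl rfl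
  -- The formula of A on `M + 1 + N` columns; rewriting its left side factors off the right block.
  · have key := gridMatrix_eq_skewSuperSchur w hff ha1 hb1 (M + 1 + N) h (extendBottom M N 0 lam) mu
      (hright N 0) hmuS (fun i => by simpa using hbottom N 0 i)
      (fun i => (hmult i).trans_le (Nat.le_add_right _ _))
      (show _ = M + 1 - l by omega) (add_comm N l)
    rw [addRho_extendBottom M N 0 lam hl, spinConfig_extendBottomStrict_zero,
      spinConfig_add_of_lt N hmult, gridMatrix_append_right,
      gridMatrix_domainWall_right w hff ha1 hb1] at key
    rw [eq_div_iff, key]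
    refine mul_ne_zero (Finset.prod_ne_zero_iff.2 fun i _ => hc1 i)
      (Finset.prod_ne_zero_iff.2 fun i _ => Finset.prod_ne_zero_iff.2 fun j hj => ?_)
    exact hd i j (Finset.mem_filter.1 hj).2
  · have key := gridMatrix_eq_skewSuperSchur w hff ha1 hb1 (N + (M + 1)) h (extendBottom M 0 N lam)
      (extendTop N mu) (hright 0 N) htopS (fun i => by simpa using hbottom 0 N i)
      (fun i => by rw [addRho_extendTop]; exact extendTopStrict_lt hmult i)
      (show _ = M + 1 + N - l by omega) (zero_add l)
    -- With `s = 0` nothing is prepended; only the index type `Fin (0 + l)` differs.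
    have hzero : spinConfig (M + 1) (extendBottomStrict M 0 0 (addRho lam)) =
        spinConfig (M + 1) (addRho lam) := by
      funext c
      exact boundarySpin_congr ((exists_append_eq _ _ _).trans (by simp))
    rw [addRho_extendBottom M 0 N lam hl, extendBottomStrict_eq_add, spinConfig_add_shift, hzero,
      addRho_extendTop, spinConfig_extendTopStrict, gridMatrix_append_left,
      gridMatrix_domainWall_left w hff ha1 hb1] at key
    rw [eq_div_iff, mul_comm, key]
    refine mul_ne_zero (Finset.prod_ne_zero_iff.2 fun i _ => hc2 i)
      (Finset.prod_ne_zero_iff.2 fun i _ => Finset.prod_ne_zero_iff.2 fun j hj => ?_)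
    exact hd i j (Finset.mem_filter.1 hj).2
  -- Blocks on both sides: the left one is cut off before the right one.
  · have key := gridMatrix_eq_skewSuperSchur w hff ha1 hb1 (N + (M + 1 + N)) h
      (extendBottom M N N lam) (extendTop N mu) (hright N N) htopS (hbottom N N)
      (fun i => by
        rw [addRho_extendTop]
        exact extendTopStrict_lt (fun i => (hmult i).trans_le (Nat.le_add_right _ _)) i)
      (show _ = M + 1 + N - l by omega) (add_comm N l)
    rw [addRho_extendBottom M N N lam hl, extendBottomStrict_eq_add, spinConfig_add_shift,
      spinConfig_extendBottomStrict_zero, addRho_extendTop, spinConfig_extendTopStrict,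
      spinConfig_add_of_lt N hmult, gridMatrix_append_left, gridMatrix_append_right,
      gridMatrix_domainWall_left w hff ha1 hb1, gridMatrix_domainWall_right w hff ha1 hb1] at key
    rw [eq_div_iff, ← key, Finset.prod_mul_distrib, prod_prod_ne]
    · ring
    refine mul_ne_zero (Finset.prod_ne_zero_iff.2 fun i _ => mul_ne_zero (hc1 i) (hc2 i))
      (Finset.prod_ne_zero_iff.2 fun i _ => Finset.prod_ne_zero_iff.2 fun j hj => ?_)
    exact hd i j (Finset.mem_filter.1 hj).2
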